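/- Let $s$ be the Fréchet space of sequences $\xi=(\xi_j)_{j\ge1}\in\mathbb C^{\mathbb N}$ with $|\xi|_q:=(\sum_j|\xi_j|^2j^{2q})^{1/2}<\infty$ for all $q\in\mathbb N_0$, with the topology of the norms $|\cdot|_q$, and let $s'$ be the space of sequences with $|\xi|'_q:=(\sum_j|\xi_j|^2j^{-2q})^{1/2}<\infty$ for some $q\in\mathbb N_0$, with the locally convex inductive limit topology. Put $\langle\xi,\eta\rangle=\sum_j\xi_j\overline{\eta_j}$. Let $\mathcal L(s',s)$ be the algebra of continuous linear operators $s'\to s$ with the topology of uniform convergence on bounded subsets of $s'$, the multiplication $xy=x\circ j\circ y$, where $j\colon s\hookrightarrow s'$ is the inclusion, and the hermitian adjoint of operators on $\ell_2$ as involution. A closed commutative $*$-subalgebra of $\mathcal L(s',s)$ is *maximal commutative* if it is not properly contained in any other closed commutative $*$-subalgebra. The *canonical Schauder basis* of a closed commutative $*$-subalgebra $E$ consists of all nonzero minimal projections of $E$, each listed once. A sequence $(f_k)_{k\in\mathbb N}$ of elements of $s$ that is orthonormal in $\ell_2$ is *$s$-complete* if the only $\xi\in s$ with $\langle\xi,f_k\rangle=0$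 for all $k$ is $\xi=0$. For an orthonormal sequence $(f_k)$ in $s$, let $\lambda^\infty(|f_k|_q)$ be the Fréchet $*$-algebra of sequences $\xi$ with $\sup_k|\xi_k|\,|f_k|_q<\infty$ for all $q\in\mathbb N_0$, with the topology of these seminorms and pointwise multiplication and conjugation; let $e_k$ be its $k$-th unit vector. An isomorphism of Fréchet $*$-algebras is a $*$-isomorphism that is a homeomorphism. 1. Every closed maximal commutative $*$-subalgebra $E$ of $\mathcal L(s',s)$ is isomorphic as a Fréchet $*$-algebra to $\lambda^\infty(|f_k|_q)$ for some $s$-complete orthonormal sequence $(f_k)_{k\in\mathbb N}$, which can be chosen so that $(\langle\cdot,f_k\rangle f_k)_{k\in\mathbb N}$ is the canonical Schauder basis of $E$. 2. More precisely, if $E$ is a closed maximal commutative $*$-subalgebra of $\mathcal L(s',s)$ whose canonical Schauder basis is $(\langle\cdot,f_k\rangle f_k)_{k\in\mathbb N}$ for an orthonormal sequence $(f_k)_{k\in\mathbb N}$ in $s$, then $(f_k)$ is $s$-complete and there is exactly one isomorphism of Fréchet $*$-algebras $E\to\lambda^\infty(|f_k|_q)$ with $\langle\cdot,f_k\rangle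 f_k\mapsto e_k$ for all $k\in\mathbb N$. 3. Conversely, if $(f_k)_{k\in\mathbb N}$ is an $s$-complete orthonormal sequence, then $\lambda^\infty(|f_k|_q)$ is isomorphic as a Fréchet $*$-algebra to some closed maximal commutative $*$-subalgebra of $\mathcal L(s',s)$. -/

import Mathlib

open scoped ComplexConjugate

noncomputable section

namespace SmoothOp

/-! ### Weighted `ℓ₂`-norms of sequences

Sequences are indexed by `j = 0, 1, 2, …`, so that the weight of the `j`-th coordinate is a power
of `j + 1`. -/

/-- `∑ |ξ_j|² (j+1)^{2q} < ∞`. -/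
def WSummable (q : ℤ) (ξ : ℕ → ℂ) : Prop :=
  Summable fun j : ℕ => ‖ξ j‖ ^ 2 * ((j : ℝ) + 1) ^ (2 * q)

/-- `(∑ |ξ_j|² (j+1)^{2q})^{1/2}`. For `q ≥ 0` this is `|ξ|_q`; with `-q` in place of `q` it is
the dual norm `|ξ|'_q`. -/
def wnorm (q : ℤ) (ξ : ℕ → ℂ) : ℝ :=
  Real.sqrt (∑' j : ℕ, ‖ξ j‖ ^ 2 * ((j : ℝ) + 1) ^ (2 * q))

theorem wnorm_nonneg (q : ℤ) (ξ : ℕ → ℂ) : 0 ≤ wnorm q ξ := Real.sqrt_nonneg _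

theorem norm_weight (q : ℤ) (ξ : ℕ → ℂ) (j : ℕ) :
    ‖(((((j : ℝ) + 1) ^ q : ℝ)) : ℂ) * ξ j‖ ^ (2 : ENNReal).toReal
      = ‖ξ j‖ ^ 2 * ((j : ℝ) + 1) ^ (2 * q) := by
  have h : (0 : ℝ) < (j : ℝ) + 1 := by positivity
  have h2 : (0 : ℝ) < ((j : ℝ) + 1) ^ q := zpow_pos h q
  rw [norm_mul, Complex.norm_real, Real.norm_of_nonneg h2.le]
  have : (2 : ENNReal).toReal = ((2 : ℕ) : ℝ) := by simp
  rw [this, Real.rpow_natCast, mul_pow, mul_comm, mul_comm (2 : ℤ) q, zpow_mul]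
  norm_cast

/-- The weighted sequence `((j+1)^q ξ_j)` as an element of `ℓ₂`. -/
def toL2 (q : ℤ) (ξ : ℕ → ℂ) (h : WSummable q ξ) : lp (fun _ : ℕ => ℂ) 2 :=
  ⟨fun j => (((((j : ℝ) + 1) ^ q : ℝ)) : ℂ) * ξ j,
    memℓp_gen (by simp only [norm_weight]; exact h)⟩

theorem norm_toL2 (q : ℤ) (ξ : ℕ → ℂ) (h : WSummable q ξ) : ‖toL2 q ξ h‖ = wnorm q ξ := by
  rw [lp.norm_eq_tsum_rpow (by simp)]
  simp only [toL2, norm_weight]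
  rw [wnorm, Real.sqrt_eq_rpow]
  simp

theorem wsummable_of_memℓp {q : ℤ} {ξ : ℕ → ℂ}
    (h : Memℓp (fun j : ℕ => (((((j : ℝ) + 1) ^ q : ℝ)) : ℂ) * ξ j) 2) : WSummable q ξ := by
  have := (memℓp_gen_iff (by simp)).1 h
  simp only [norm_weight] at this
  exact this

theorem WSummable.add {q : ℤ} {ξ η : ℕ → ℂ} (hξ : WSummable q ξ) (hη : WSummable q η) :
    WSummable q (ξ + η) := by
  apply wsummable_of_memℓp
  have h : (fun j : ℕ => (((((j : ℝ) + 1) ^ q : ℝ)) : ℂ) * (ξ + η) j)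
      = (toL2 q ξ hξ + toL2 q η hη : lp (fun _ : ℕ => ℂ) 2) :=
    funext fun j => mul_add _ (ξ j) (η j)
  rw [h]
  exact (toL2 q ξ hξ + toL2 q η hη).2

theorem WSummable.smul {q : ℤ} {ξ : ℕ → ℂ} (c : ℂ) (hξ : WSummable q ξ) :
    WSummable q (c • ξ) := by
  refine (Summable.mul_left (‖c‖ ^ 2) hξ).congr fun j => ?_
  simp [mul_pow, mul_assoc]

theorem wsummable_zero (q : ℤ) : WSummable q 0 := by simp [WSummable, summable_zero]

theorem WSummable.mono {q r : ℤ} (hqr : q ≤ r) {ξ : ℕ → ℂ} (h : WSummable r ξ) :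
    WSummable q ξ := by
  refine Summable.of_nonneg_of_le (fun j => by positivity) (fun j => ?_) h
  have : (1 : ℝ) ≤ (j : ℝ) + 1 := by simp
  gcongr

theorem wnorm_add_le {q : ℤ} {ξ η : ℕ → ℂ} (hξ : WSummable q ξ) (hη : WSummable q η) :
    wnorm q (ξ + η) ≤ wnorm q ξ + wnorm q η := by
  rw [← norm_toL2 q ξ hξ, ← norm_toL2 q η hη, ← norm_toL2 q _ (hξ.add hη)]
  have : toL2 q _ (hξ.add hη) = toL2 q ξ hξ + toL2 q η hη := by
    ext j
    exact mul_add _ (ξ j) (η j)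
  rw [this]
  exact norm_add_le _ _

theorem wnorm_smul (q : ℤ) (c : ℂ) (ξ : ℕ → ℂ) : wnorm q (c • ξ) = ‖c‖ * wnorm q ξ := by
  have : (fun j : ℕ => ‖(c • ξ) j‖ ^ 2 * ((j : ℝ) + 1) ^ (2 * q))
      = fun j : ℕ => ‖c‖ ^ 2 * (‖ξ j‖ ^ 2 * ((j : ℝ) + 1) ^ (2 * q)) := by
    funext j
    simp [mul_pow, mul_assoc]
  rw [wnorm, wnorm, this, tsum_mul_left, Real.sqrt_mul (by positivity),
    Real.sqrt_sq (norm_nonneg c)]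

theorem wnorm_mono {q r : ℤ} (hqr : q ≤ r) {ξ : ℕ → ℂ} (h : WSummable r ξ) :
    wnorm q ξ ≤ wnorm r ξ := by
  refine Real.sqrt_le_sqrt ((h.mono hqr).tsum_le_tsum (fun j => ?_) h)
  have : (1 : ℝ) ≤ (j : ℝ) + 1 := by simp
  gcongr

theorem inner_weight (q : ℤ) (ξ η : ℕ → ℂ) (j : ℕ) :
    inner ℂ ((((((j : ℝ) + 1) ^ q : ℝ)) : ℂ) * η j) ((((((j : ℝ) + 1) ^ (-q) : ℝ)) : ℂ) * ξ j)
      = ξ j * conj (η j) := by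
  have h : ((j : ℝ) + 1) ≠ 0 := by positivity
  have h2 : ((j : ℝ) + 1) ^ (-q) * ((j : ℝ) + 1) ^ q = 1 := by
    rw [← zpow_add₀ h]; simp
  have h3 : ((((((j : ℝ) + 1) ^ (-q) : ℝ)) : ℂ)) * (((((j : ℝ) + 1) ^ q : ℝ)) : ℂ) = 1 := by
    exact_mod_cast h2
  rw [RCLike.inner_apply, map_mul, Complex.conj_ofReal]
  linear_combination (ξ j * conj (η j)) * h3

theorem summable_pairing {q : ℤ} {ξ η : ℕ → ℂ} (hξ : WSummable (-q) ξ) (hη : WSummable q η) :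
    Summable fun j => ξ j * conj (η j) := by
  have := lp.summable_inner (𝕜 := ℂ) (toL2 q η hη) (toL2 (-q) ξ hξ)
  simpa only [toL2, inner_weight] using this

theorem norm_pairing_le {q : ℤ} {ξ η : ℕ → ℂ} (hξ : WSummable (-q) ξ) (hη : WSummable q η) :
    ‖∑' j, ξ j * conj (η j)‖ ≤ wnorm (-q) ξ * wnorm q η := by
  have h := lp.inner_eq_tsum (𝕜 := ℂ) (toL2 q η hη) (toL2 (-q) ξ hξ)
  simp only [toL2, inner_weight] at h
  rw [← h, ← norm_toL2 q η hη, ← norm_toL2 (-q) ξ hξ, mul_comm]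
  exact norm_inner_le_norm _ _

/-! ### The space `s` of rapidly decreasing sequences -/

/-- The vector space underlying `s`. -/
def sSubmodule : Submodule ℂ (ℕ → ℂ) where
  carrier := {ξ | ∀ q : ℕ, WSummable q ξ}
  add_mem' h h' q := (h q).add (h' q)
  zero_mem' q := wsummable_zero q
  smul_mem' c _ h q := (h q).smul c

/-- The space `s` of rapidly decreasing sequences. -/
def S : Type := sSubmodule

instance : AddCommGroup S := inferInstanceAs (AddCommGroup sSubmodule)
instance : Module ℂ S := inferInstanceAs (Module ℂ sSubmodule)
instance : CoeFun S (fun _ => ℕ → ℂ) := ⟨fun ξ => Subtype.val ξ⟩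

/-- The norm `|·|_q` on `s`. -/
def S.norm (q : ℕ) : Seminorm ℂ S :=
  Seminorm.of (fun ξ : S => wnorm q ξ)
    (fun ξ η => wnorm_add_le (ξ.2 q) (η.2 q)) (fun c ξ => wnorm_smul q c ξ)

/-- The system `(|·|_q)_q` of norms of `s`. -/
def S.norms : SeminormFamily ℂ S ℕ := S.norm

/-- The topology of `s` is given by the norms `|·|_q`. -/
instance : TopologicalSpace S := S.norms.moduleFilterBasis.topology

theorem S.withSeminorms : WithSeminorms S.norms := ⟨rfl⟩

instance : IsTopologicalAddGroup S := S.withSeminorms.topologicalAddGroup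
instance : ContinuousSMul ℂ S := S.withSeminorms.continuousSMul

/-! ### The space `s'` of slowly increasing sequences -/

/-- The vector space underlying `s'`. -/
def sDualSubmodule : Submodule ℂ (ℕ → ℂ) where
  carrier := {ξ | ∃ q : ℕ, WSummable (-(q : ℤ)) ξ}
  add_mem' := by
    rintro ξ η ⟨q, hq⟩ ⟨r, hr⟩
    exact ⟨max q r, (hq.mono (by simp)).add (hr.mono (by simp))⟩
  zero_mem' := ⟨0, wsummable_zero _⟩
  smul_mem' c _ h := ⟨h.choose, h.choose_spec.smul c⟩

/-- The space `s'` of slowly increasing sequences. -/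
def SDual : Type := sDualSubmodule

instance : AddCommGroup SDual := inferInstanceAs (AddCommGroup sDualSubmodule)
instance : Module ℂ SDual := inferInstanceAs (Module ℂ sDualSubmodule)
instance : CoeFun SDual (fun _ => ℕ → ℂ) := ⟨fun ξ => Subtype.val ξ⟩

/-- A seminorm on `s'` whose restriction to each step `{ξ : |ξ|'_q < ∞}` is continuous for the
norm `|·|'_q`. -/
def SDual.Admissible (p : Seminorm ℂ SDual) : Prop :=
  ∀ q : ℕ, ∃ C : ℝ, ∀ ξ : SDual, WSummable (-(q : ℤ)) ξ → p ξ ≤ C * wnorm (-(q : ℤ)) ξ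

/-- The family of all admissible seminorms on `s'`. -/
def SDual.seminorms : SeminormFamily ℂ SDual {p : Seminorm ℂ SDual // SDual.Admissible p} :=
  fun p => p.1

instance : Nonempty {p : Seminorm ℂ SDual // SDual.Admissible p} :=
  ⟨⟨0, fun _ => ⟨0, fun ξ _ => by simp⟩⟩⟩

/-- The (locally convex) inductive limit topology of `s'`: the finest locally convex topology for
which the inclusions of all the steps `({ξ : |ξ|'_q < ∞}, |·|'_q)` are continuous, that is, the
one given by all seminorms that are continuous on every step. -/
instance : TopologicalSpace SDual := SDual.seminorms.moduleFilterBasis.topology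

theorem SDual.withSeminorms : WithSeminorms SDual.seminorms := ⟨rfl⟩

instance : IsTopologicalAddGroup SDual := SDual.withSeminorms.topologicalAddGroup
instance : ContinuousSMul ℂ SDual := SDual.withSeminorms.continuousSMul

theorem SDual.continuous_of_admissible {p : Seminorm ℂ SDual} (hp : SDual.Admissible p) :
    Continuous p :=
  SDual.withSeminorms.continuous_seminorm ⟨p, hp⟩

theorem SDual.admissible_of_continuous {p : Seminorm ℂ SDual} (hp : Continuous p) :
    SDual.Admissible p := by
  obtain ⟨t, C, -, hC⟩ := Seminorm.bound_of_continuous SDual.withSeminorms p hp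
  intro q
  have key : ∃ D : ℝ, ∀ ξ : SDual, WSummable (-(q : ℤ)) ξ →
      (t.sup SDual.seminorms) ξ ≤ D * wnorm (-(q : ℤ)) ξ := by
    clear hC
    classical
    induction t using Finset.induction_on with
    | empty => exact ⟨0, fun ξ _ => by simp⟩
    | insert a t _ ih =>
      obtain ⟨D, hD⟩ := ih
      obtain ⟨D', hD'⟩ := a.2 q
      refine ⟨max D' D, fun ξ hξ => ?_⟩
      rw [Finset.sup_insert, Seminorm.sup_apply]
      exact max_le
        ((hD' ξ hξ).trans (mul_le_mul_of_nonneg_right (le_max_left _ _) (wnorm_nonneg _ _)))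
        ((hD ξ hξ).trans (mul_le_mul_of_nonneg_right (le_max_right _ _) (wnorm_nonneg _ _)))
  obtain ⟨D, hD⟩ := key
  refine ⟨C * D, fun ξ hξ => (hC ξ).trans ?_⟩
  rw [smul_apply, NNReal.smul_def, smul_eq_mul, mul_assoc]
  exact mul_le_mul_of_nonneg_left (hD ξ hξ) C.2

/-- A linear map `s' → s` that is bounded from every step to every normed level is continuous. -/
def SDual.mkCLM (T : SDual →ₗ[ℂ] S)
    (hT : ∀ q r : ℕ, ∃ C : ℝ, ∀ ξ : SDual, WSummable (-(r : ℤ)) ξ →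
      wnorm q (T ξ) ≤ C * wnorm (-(r : ℤ)) ξ) : SDual →L[ℂ] S :=
  ⟨T, WithSeminorms.continuous_of_continuous_comp S.withSeminorms T fun q =>
    SDual.continuous_of_admissible (hT q)⟩

theorem SDual.exists_bound (x : SDual →L[ℂ] S) (q r : ℕ) :
    ∃ C : ℝ, ∀ ξ : SDual, WSummable (-(r : ℤ)) ξ → wnorm q (x ξ) ≤ C * wnorm (-(r : ℤ)) ξ :=
  SDual.admissible_of_continuous (p := (S.norm q).comp x.toLinearMap)
    ((S.withSeminorms.continuous_seminorm q).comp x.continuous) r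

/-- The embedding `j : s ↪ s'`. -/
def incl : S →L[ℂ] SDual where
  toFun ξ := ⟨ξ.1, 0, by simpa using ξ.2 0⟩
  map_add' _ _ := rfl
  map_smul' _ _ := rfl
  cont := by
    let T : S →ₗ[ℂ] SDual :=
      { toFun := fun ξ => ⟨ξ.1, 0, by simpa using ξ.2 0⟩
        map_add' := fun _ _ => rfl
        map_smul' := fun _ _ => rfl }
    refine WithSeminorms.continuous_of_continuous_comp SDual.withSeminorms T fun p => ?_
    obtain ⟨C, hC⟩ := p.2 0
    have hle : (SDual.seminorms p).comp T ≤ (‖C‖₊ : NNReal) • S.norm 0 := fun ξ => by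
      refine (hC (T ξ) (ξ.2 0)).trans ?_
      rw [smul_apply, NNReal.smul_def, smul_eq_mul]
      exact mul_le_mul_of_nonneg_right (Real.le_norm_self C) (wnorm_nonneg _ _)
    exact Seminorm.continuous_of_le
      ((S.withSeminorms.continuous_seminorm 0).const_smul (‖C‖₊ : NNReal)) hle

/-- The pairing `⟨η, ξ⟩ = ∑ η_j conj(ξ_j)` of `η ∈ s'` and `ξ ∈ s`. -/
def pair (η : SDual) (ξ : S) : ℂ := ∑' j, η j * conj (ξ j)

theorem summable_pair (η : SDual) (ξ : S) : Summable fun j => η j * conj (ξ j) := by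
  obtain ⟨q, hq⟩ := η.2
  exact summable_pairing hq (ξ.2 q)

theorem norm_pair_le {q : ℕ} {η : SDual} (hη : WSummable (-(q : ℤ)) η) (ξ : S) :
    ‖pair η ξ‖ ≤ wnorm (-(q : ℤ)) η * wnorm q ξ :=
  norm_pairing_le hη (ξ.2 q)

theorem pair_add (η η' : SDual) (ξ : S) : pair (η + η') ξ = pair η ξ + pair η' ξ := by
  unfold pair
  rw [← (summable_pair η ξ).tsum_add (summable_pair η' ξ)]
  exact tsum_congr fun j => add_mul (η j) (η' j) _

theorem pair_smul (c : ℂ) (η : SDual) (ξ : S) : pair (c • η) ξ = c * pair η ξ := by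
  unfold pair
  rw [← tsum_mul_left]
  exact tsum_congr fun j => mul_assoc c (η j) _

/-! ### The algebra `𝓛(s', s)` -/

/-- The space `𝓛(s', s)` of continuous linear operators from `s'` to `s`, with the topology of
uniform convergence on bounded subsets of `s'`. -/
def LSS : Type := SDual →L[ℂ] S

instance : AddCommGroup LSS := inferInstanceAs (AddCommGroup (SDual →L[ℂ] S))
instance : Module ℂ LSS := inferInstanceAs (Module ℂ (SDual →L[ℂ] S))
instance : TopologicalSpace LSS := inferInstanceAs (TopologicalSpace (SDual →L[ℂ] S))
instance : FunLike LSS SDual S := inferInstanceAs (FunLike (SDual →L[ℂ] S) SDual S)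

/-- The multiplication `x y = x ∘ j ∘ y`. -/
instance : Mul LSS := ⟨fun x y =>
  (ContinuousLinearMap.comp (show SDual →L[ℂ] S from x)
    (incl.comp (show SDual →L[ℂ] S from y)) : SDual →L[ℂ] S)⟩

theorem LSS.mul_apply (x y : LSS) (ξ : SDual) : (x * y) ξ = x (incl (y ξ)) := rfl

theorem LSS.ext {x y : LSS} (h : ∀ ξ, x ξ = y ξ) : x = y := DFunLike.ext _ _ h

theorem LSS.map_add (x : LSS) (ξ η : SDual) : x (ξ + η) = x ξ + x η :=
  ContinuousLinearMap.map_add (show SDual →L[ℂ] S from x) ξ η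

theorem LSS.map_zero (x : LSS) : x 0 = 0 :=
  ContinuousLinearMap.map_zero (show SDual →L[ℂ] S from x)

theorem LSS.map_smul (x : LSS) (c : ℂ) (ξ : SDual) : x (c • ξ) = c • x ξ :=
  ContinuousLinearMap.map_smul (show SDual →L[ℂ] S from x) c ξ

instance : NonUnitalRing LSS :=
  { (inferInstance : AddCommGroup LSS), (inferInstance : Mul LSS) with
    left_distrib := fun x y z => LSS.ext fun ξ => by
      change x (incl (y ξ + z ξ)) = x (incl (y ξ)) + x (incl (z ξ))
      rw [_root_.map_add, LSS.map_add]
    right_distrib := fun _ _ _ => rfl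
    zero_mul := fun _ => rfl
    mul_zero := fun x => LSS.ext fun ξ => by
      change x (incl 0) = 0
      rw [_root_.map_zero, LSS.map_zero]
    mul_assoc := fun _ _ _ => rfl }

/-- The unit vector `e_i` as an element of `s'`. -/
def unitVec (i : ℕ) : SDual :=
  ⟨Pi.single i 1, 0, summable_of_ne_finset_zero (s := {i}) fun j hj => by
    have : j ≠ i := by simpa using hj
    simp [this]⟩

theorem unitVec_wsummable (q : ℤ) (i : ℕ) : WSummable q (unitVec i) :=
  summable_of_ne_finset_zero (s := {i}) fun j hj => by
    have : j ≠ i := by simpa using hj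
    simp [unitVec, this]

theorem wnorm_unitVec (q : ℤ) (i : ℕ) : wnorm q (unitVec i) = ((i : ℝ) + 1) ^ q := by
  rw [wnorm, tsum_eq_single i (fun j hj => by simp [unitVec, hj])]
  have h : (0 : ℝ) < (i : ℝ) + 1 := by positivity
  simp only [unitVec, Pi.single_eq_same, norm_one, one_pow, one_mul]
  rw [mul_comm, zpow_mul, zpow_ofNat, Real.sqrt_sq (zpow_pos h q).le]

theorem summable_inv_sq : Summable fun j : ℕ => ((j : ℝ) + 1) ^ (-2 : ℤ) := by
  have h := (summable_nat_add_iff 1).2 (Real.summable_nat_pow_inv.2 (one_lt_two))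
  refine h.congr fun j => ?_
  rw [zpow_neg]
  norm_cast

/-- A sequence bounded by `D (j+1)^{-(q+1)}` has finite norm `|·|_q`, controlled by `D`. -/
theorem wsummable_of_bound {q : ℕ} {D : ℝ} {ζ : ℕ → ℂ}
    (h : ∀ j : ℕ, ‖ζ j‖ ≤ D * ((j : ℝ) + 1) ^ (-((q : ℤ) + 1))) :
    WSummable q ζ ∧ wnorm q ζ ≤ D * Real.sqrt (∑' j : ℕ, ((j : ℝ) + 1) ^ (-2 : ℤ)) := by
  have hD : 0 ≤ D := by simpa using (norm_nonneg _).trans (h 0)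
  have hle : ∀ j : ℕ, ‖ζ j‖ ^ 2 * ((j : ℝ) + 1) ^ (2 * (q : ℤ))
      ≤ D ^ 2 * ((j : ℝ) + 1) ^ (-2 : ℤ) := by
    intro j
    have hj : ((j : ℝ) + 1) ≠ 0 := by positivity
    calc ‖ζ j‖ ^ 2 * ((j : ℝ) + 1) ^ (2 * (q : ℤ))
        ≤ (D * ((j : ℝ) + 1) ^ (-((q : ℤ) + 1))) ^ 2 * ((j : ℝ) + 1) ^ (2 * (q : ℤ)) := by
          gcongr
          exact h j
      _ = D ^ 2 * ((j : ℝ) + 1) ^ (-2 : ℤ) := by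
          rw [mul_pow, mul_assoc, ← zpow_natCast (((j : ℝ) + 1) ^ (-((q : ℤ) + 1))) 2,
            ← zpow_mul, ← zpow_add₀ hj]
          congr 2
          push_cast
          ring
  have hs := summable_inv_sq.mul_left (D ^ 2)
  have hw : WSummable q ζ := Summable.of_nonneg_of_le (fun j => by positivity) hle hs
  refine ⟨hw, ?_⟩
  have h2 := Real.sqrt_le_sqrt (hw.tsum_le_tsum hle hs)
  rwa [tsum_mul_left, Real.sqrt_mul (by positivity), Real.sqrt_sq hD] at h2

theorem LSS.adjoint_bound (x : LSS) (q r : ℕ) :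
    ∃ C : ℝ, ∀ ξ : SDual, WSummable (-(r : ℤ)) ξ → ∀ i : ℕ,
      ‖pair ξ (x (unitVec i))‖ ≤ C * wnorm (-(r : ℤ)) ξ * ((i : ℝ) + 1) ^ (-((q : ℤ) + 1)) := by
  obtain ⟨C, hC⟩ := SDual.exists_bound x r (q + 1)
  refine ⟨C, fun ξ hξ i => (norm_pair_le hξ _).trans ?_⟩
  have h := hC (unitVec i) (unitVec_wsummable _ i)
  rw [wnorm_unitVec] at h
  push_cast at h
  calc _ ≤ wnorm (-(r : ℤ)) ξ * (C * ((i : ℝ) + 1) ^ (-((q : ℤ) + 1))) :=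
        mul_le_mul_of_nonneg_left h (wnorm_nonneg _ _)
    _ = _ := by ring

/-- The hermitian adjoint of `x`: its `i`-th coordinate is `⟨x* ξ, e_i⟩ = ⟨ξ, x e_i⟩`. -/
def LSS.adjoint (x : LSS) : LSS :=
  SDual.mkCLM
    { toFun := fun ξ => ⟨fun i => pair ξ (x (unitVec i)), fun q => by
        obtain ⟨r, hr⟩ := ξ.2
        obtain ⟨C, hC⟩ := x.adjoint_bound q r
        exact (wsummable_of_bound (hC ξ hr)).1⟩
      map_add' := fun ξ η => Subtype.ext (funext fun i => pair_add ξ η _)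
      map_smul' := fun c ξ => Subtype.ext (funext fun i => pair_smul c ξ _) }
    (fun q r => by
      obtain ⟨C, hC⟩ := x.adjoint_bound q r
      refine ⟨C * Real.sqrt (∑' j : ℕ, ((j : ℝ) + 1) ^ (-2 : ℤ)), fun ξ hξ => ?_⟩
      refine (wsummable_of_bound (hC ξ hξ)).2.trans (le_of_eq ?_)
      ring)

/-- The involution of `𝓛(s', s)` is the hermitian adjoint. -/
instance : Star LSS := ⟨LSS.adjoint⟩

/-- The one-dimensional operator `⟨·, f⟩ f` for `f ∈ s`. -/
def rankOne (f : S) : LSS :=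
  SDual.mkCLM
    { toFun := fun ξ => pair ξ f • f
      map_add' := fun ξ η => by rw [pair_add, add_smul]
      map_smul' := fun c ξ => by rw [pair_smul, mul_smul]; rfl }
    (fun q r => ⟨wnorm r f * wnorm q f, fun ξ hξ => by
      refine (wnorm_smul q (pair ξ f) f).trans_le ?_
      calc _ ≤ (wnorm (-(r : ℤ)) ξ * wnorm r f) * wnorm q f :=
            mul_le_mul_of_nonneg_right (norm_pair_le hξ f) (wnorm_nonneg _ _)
        _ = _ := by ring⟩)

/-! ### Closed maximal commutative `*`-subalgebras and their canonical bases -/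

/-- `E` is a closed commutative `*`-subalgebra of `𝓛(s', s)`. -/
def IsClosedCommutative (E : NonUnitalStarSubalgebra ℂ LSS) : Prop :=
  IsClosed (E : Set LSS) ∧ ∀ x ∈ E, ∀ y ∈ E, x * y = y * x

/-- `E` is a closed maximal commutative `*`-subalgebra: closed, commutative, and not properly
contained in any other closed commutative `*`-subalgebra. -/
def IsClosedMaximalCommutative (E : NonUnitalStarSubalgebra ℂ LSS) : Prop :=
  IsClosedCommutative E ∧
    ∀ F : NonUnitalStarSubalgebra ℂ LSS, IsClosedCommutative F → E ≤ F → F = E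

/-- `P` is a minimal element among the nonzero projections of `E`, where `Q ≤ P` means
`Q P = Q`. -/
structure IsMinimalProjection (E : NonUnitalStarSubalgebra ℂ LSS) (P : LSS) : Prop where
  mem : P ∈ E
  isStarProjection : IsStarProjection P
  ne_zero : P ≠ 0
  minimal : ∀ Q ∈ E, IsStarProjection Q → Q ≠ 0 → Q * P = Q → Q = P

/-- `(P_k)` is the canonical Schauder basis of `E`: it consists of all the nonzero minimal
projections of `E`, each listed once. (That these form a Schauder basis is a consequence.) -/
structure IsCanonicalBasis (E : NonUnitalStarSubalgebra ℂ LSS) (P : ℕ → LSS) : Prop where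
  injective : Function.Injective P
  isMinimalProjection : ∀ k, IsMinimalProjection E (P k)
  exhaustive : ∀ Q, IsMinimalProjection E Q → ∃ k, P k = Q

/-! ### Orthonormal sequences in `s` -/

/-- A sequence of elements of `s` that is orthonormal in `ℓ₂`. -/
structure OrthonormalSeq where
  toFun : ℕ → S
  orthonormal : ∀ k l, pair (incl (toFun k)) (toFun l) = if k = l then 1 else 0

instance : CoeFun OrthonormalSeq (fun _ => ℕ → S) := ⟨OrthonormalSeq.toFun⟩

/-- `(f_k)` is `s`-complete: no nonzero element of `s` is orthogonal to all `f_k`. -/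
def OrthonormalSeq.IsSComplete (f : OrthonormalSeq) : Prop :=
  ∀ ξ : S, (∀ k, pair (incl ξ) (f k) = 0) → ξ = 0

theorem OrthonormalSeq.one_le_norm (f : OrthonormalSeq) (k q : ℕ) : 1 ≤ S.norm q (f k) := by
  have h0 : WSummable (-((0 : ℕ) : ℤ)) (incl (f k)) := (f k).2 0
  have h := norm_pair_le h0 (f k)
  rw [f.orthonormal, if_pos rfl, norm_one] at h
  have h1 : 1 ≤ wnorm ((0 : ℕ) : ℤ) (f k) := by
    by_contra hlt
    have h2 : wnorm (-((0 : ℕ) : ℤ)) (incl (f k)) = wnorm ((0 : ℕ) : ℤ) (f k) := rfl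
    rw [h2] at h
    nlinarith [wnorm_nonneg ((0 : ℕ) : ℤ) (f k)]
  exact h1.trans (wnorm_mono (by simp) ((f k).2 q))

/-! ### Köthe algebras -/

/-- A Köthe matrix `(a_{j,q})`. -/
structure KotheMatrix where
  entry : ℕ → ℕ → ℝ
  nonneg : ∀ j q, 0 ≤ entry j q
  exists_pos : ∀ j, ∃ q, 0 < entry j q
  mono : ∀ j q, entry j q ≤ entry j (q + 1)

/-- The sequence `ξ` belongs to `λ^∞(A)`: `sup_j |ξ_j| a_{j,q} < ∞` for all `q`. -/
def KotheMatrix.Mem (A : KotheMatrix) (ξ : ℕ → ℂ) : Prop :=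
  ∀ q, BddAbove (Set.range fun j => ‖ξ j‖ * A.entry j q)

/-- `λ^∞(A)` is closed under pointwise multiplication. -/
class KotheMatrix.IsAlgebra (A : KotheMatrix) : Prop where
  mul_mem : ∀ ξ η : ℕ → ℂ, A.Mem ξ → A.Mem η → A.Mem (ξ * η)

/-- The `*`-algebra underlying `λ^∞(A)`, with pointwise multiplication and conjugation. -/
def kotheSubalgebra (A : KotheMatrix) [A.IsAlgebra] : NonUnitalStarSubalgebra ℂ (ℕ → ℂ) where
  carrier := {ξ | A.Mem ξ}
  add_mem' := by
    intro ξ η hξ hη q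
    obtain ⟨B, hB⟩ := hξ q
    obtain ⟨C, hC⟩ := hη q
    refine ⟨B + C, ?_⟩
    rintro _ ⟨j, rfl⟩
    have h1 := hB ⟨j, rfl⟩
    have h2 := hC ⟨j, rfl⟩
    have h3 := mul_le_mul_of_nonneg_right (norm_add_le (ξ j) (η j)) (A.nonneg j q)
    simp only [Pi.add_apply] at *
    linarith
  zero_mem' q := ⟨0, by rintro _ ⟨j, rfl⟩; simp⟩
  smul_mem' := by
    intro c ξ hξ q
    obtain ⟨B, hB⟩ := hξ q
    refine ⟨‖c‖ * B, ?_⟩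
    rintro _ ⟨j, rfl⟩
    have h1 := mul_le_mul_of_nonneg_left (hB ⟨j, rfl⟩) (norm_nonneg c)
    simpa [mul_assoc] using h1
  mul_mem' := fun hξ hη => KotheMatrix.IsAlgebra.mul_mem _ _ hξ hη
  star_mem' := by
    intro ξ hξ q
    simpa using hξ q

/-- The Köthe algebra `λ^∞(A)`. -/
def LambdaInf (A : KotheMatrix) [A.IsAlgebra] : Type := kotheSubalgebra A

section LambdaInf

variable (A : KotheMatrix) [A.IsAlgebra]

instance : NonUnitalCommRing (LambdaInf A) :=
  inferInstanceAs (NonUnitalCommRing (kotheSubalgebra A))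
instance : Module ℂ (LambdaInf A) := inferInstanceAs (Module ℂ (kotheSubalgebra A))
instance : StarRing (LambdaInf A) := inferInstanceAs (StarRing (kotheSubalgebra A))

/-- The seminorm `|ξ|_{∞,q} = sup_j |ξ_j| a_{j,q}`. -/
def LambdaInf.norm (q : ℕ) : Seminorm ℂ (LambdaInf A) :=
  Seminorm.of (fun ξ : LambdaInf A => ⨆ j, ‖ξ.1 j‖ * A.entry j q)
    (fun ξ η => by
      refine ciSup_le fun j => ?_
      have h1 := le_ciSup (ξ.2 q) j
      have h2 := le_ciSup (η.2 q) j
      have h3 := mul_le_mul_of_nonneg_right (norm_add_le (ξ.1 j) (η.1 j)) (A.nonneg j q)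
      have h4 : (ξ + η).1 j = ξ.1 j + η.1 j := rfl
      rw [h4]
      linarith)
    (fun c ξ => by
      rw [Real.mul_iSup_of_nonneg (norm_nonneg c)]
      refine iSup_congr fun j => ?_
      have h4 : (c • ξ).1 j = c * ξ.1 j := rfl
      rw [h4, norm_mul, mul_assoc])

/-- The system of seminorms of `λ^∞(A)`. -/
def LambdaInf.norms : SeminormFamily ℂ (LambdaInf A) ℕ := LambdaInf.norm A

/-- The topology of `λ^∞(A)` is given by the seminorms `|·|_{∞,q}`. -/
instance : TopologicalSpace (LambdaInf A) := (LambdaInf.norms A).moduleFilterBasis.topology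

/-- The unit vector `e_k` of `λ^∞(A)`. -/
def LambdaInf.e (k : ℕ) : LambdaInf A :=
  ⟨Pi.single k 1, fun q => ⟨A.entry k q, by
    rintro _ ⟨j, rfl⟩
    by_cases h : j = k
    · subst h; simp
    · simpa [h] using A.nonneg k q⟩⟩

end LambdaInf

/-- The Köthe matrix `(|f_k|_q)_{k,q}`. -/
def OrthonormalSeq.matrix (f : OrthonormalSeq) : KotheMatrix where
  entry k q := S.norm q (f k)
  nonneg k q := apply_nonneg _ _
  exists_pos k := ⟨0, zero_lt_one.trans_le (f.one_le_norm k 0)⟩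
  mono k q := wnorm_mono (by simp) ((f k).2 (q + 1))

instance (f : OrthonormalSeq) : f.matrix.IsAlgebra where
  mul_mem ξ η hξ hη q := by
    obtain ⟨B, hB⟩ := hξ q
    obtain ⟨C, hC⟩ := hη q
    refine ⟨B * C, ?_⟩
    rintro _ ⟨k, rfl⟩
    have h1 : ‖ξ k‖ * S.norm q (f k) ≤ B := hB ⟨k, rfl⟩
    have h2 : ‖η k‖ * S.norm q (f k) ≤ C := hC ⟨k, rfl⟩
    have h3 := f.one_le_norm k q
    have h4 : ‖η k‖ ≤ C := le_trans (le_mul_of_one_le_right (norm_nonneg _) h3) h2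
    have h5 : 0 ≤ B := le_trans (by positivity) h1
    change ‖ξ k * η k‖ * S.norm q (f k) ≤ B * C
    rw [norm_mul]
    calc ‖ξ k‖ * ‖η k‖ * S.norm q (f k) = (‖ξ k‖ * S.norm q (f k)) * ‖η k‖ := by ring
      _ ≤ B * C := mul_le_mul h1 h4 (norm_nonneg _) h5

/-- `Φ` is an isomorphism of Fréchet `*`-algebras: a bijective `*`-homomorphism that is continuous
together with its inverse. -/
def IsFrechetIso {E : NonUnitalStarSubalgebra ℂ LSS} {A : KotheMatrix} [A.IsAlgebra]
    (Φ : E ≃⋆ₐ[ℂ] LambdaInf A) : Prop :=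
  Continuous Φ ∧ Continuous Φ.symm

end SmoothOp

end

open SmoothOp

open scoped Topology

noncomputable section

namespace SmoothOp

/-! The proof diagonalizes. By maximality a closed maximal commutative `*`-subalgebra E equals its
own centralizer: the bicommutant of E together with a self-adjoint operator commuting with E is
again a closed commutative `*`-subalgebra (`IsClosedMaximalCommutative.isSelfCentralizing`). From
then on every membership in E is a commutation relation.

Each operator in 𝓛(s', s) induces a compact operator on ℓ₂, and its eigenvectors in ℓ₂ for nonzero
eigenvalues lie in s. Finite-dimensional E-invariant subspaces of s therefore arise as eigenspaces,
and each nonzero one contains a common eigenvector f of E, for which ⟨·, f⟩ f lies in E. It follows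
that the minimal projections are exactly these one-dimensional ones
(`IsMinimalProjection.exists_rankOne_eq`), that they are mutually orthogonal, and that no nonzero
element of s is orthogonal to all their ranges (`eq_zero_of_orthogonal`). There are infinitely many
since s is infinite-dimensional, and countably many by Bessel's inequality.

For an s-complete orthonormal sequence, an operator commuting with all ⟨·, f_k⟩ f_k is determined by
its diagonal entries μ_k. Since x f_k = μ_k f_k and the f_k are bounded in s', these entries lie in
λ^∞(|f_k|_q). Conversely ∑ ξ_k ⟨·, f_k⟩ f_k converges in 𝓛(s', s) for every ξ in λ^∞. This rests on
log-convexity of the norms, |f_k|_q² ≤ |f_k|_{2q}, and on the nuclearity estimate ∑ |f_k|_1^{-2} <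
∞. The same estimates give continuity of the inverse, once bounded subsets of s' are known to be
bounded in a single step (`SDual.exists_step_of_isVonNBounded`). The converse assertion takes E to
be the operators commuting with all ⟨·, f_k⟩ f_k. -/

theorem S.ext {ξ η : S} (h : ∀ j, ξ j = η j) : ξ = η := Subtype.ext (funext h)

theorem SDual.ext {ξ η : SDual} (h : ∀ j, ξ j = η j) : ξ = η := Subtype.ext (funext h)

theorem incl_apply (ξ : S) (j : ℕ) : incl ξ j = ξ j := rfl

theorem S.add_apply (ξ η : S) (j : ℕ) : (ξ + η) j = ξ j + η j := rfl

theorem S.smul_apply (c : ℂ) (ξ : S) (j : ℕ) : (c • ξ) j = c * ξ j := rfl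

theorem SDual.smul_apply (c : ℂ) (ξ : SDual) (j : ℕ) : (c • ξ) j = c * ξ j := rfl

theorem incl_wsummable (ξ : S) (q : ℕ) : WSummable (-(q : ℤ)) (incl ξ) :=
  (ξ.2 0).mono (by simp)

/-! ### Coordinates and pairings -/

theorem norm_coord_le {q : ℤ} {ξ : ℕ → ℂ} (h : WSummable q ξ) (j : ℕ) :
    ‖ξ j‖ * ((j : ℝ) + 1) ^ q ≤ wnorm q ξ := by
  have hj : (0 : ℝ) < (j : ℝ) + 1 := by positivity
  refine Real.le_sqrt_of_sq_le ?_
  have h1 := h.le_tsum j fun i _ => by positivity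
  refine le_trans (le_of_eq ?_) h1
  rw [mul_pow, ← zpow_natCast (((j : ℝ) + 1) ^ q) 2, ← zpow_mul, mul_comm q]
  rfl

theorem pair_unitVec (ξ : S) (i : ℕ) : pair (unitVec i) ξ = conj (ξ i) := by
  unfold pair
  rw [tsum_eq_single i (fun j hj => by simp [unitVec, hj])]
  simp [unitVec]

theorem pair_incl_conj (ξ η : S) : conj (pair (incl ξ) η) = pair (incl η) ξ := by
  unfold pair
  rw [Complex.conj_tsum]
  exact tsum_congr fun j => by simp [incl_apply, mul_comm]

theorem pair_add_right (η : SDual) (ξ ξ' : S) : pair η (ξ + ξ') = pair η ξ + pair η ξ' := by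
  unfold pair
  rw [← (summable_pair η ξ).tsum_add (summable_pair η ξ')]
  exact tsum_congr fun j => by rw [S.add_apply, map_add, mul_add]

theorem pair_smul_right (c : ℂ) (η : SDual) (ξ : S) : pair η (c • ξ) = conj c * pair η ξ := by
  unfold pair
  rw [← tsum_mul_left]
  exact tsum_congr fun j => by rw [S.smul_apply, map_mul]; ring

/-- The functional `ξ ↦ ⟨ξ, f⟩` on `s'`. -/
def pairCLM (f : S) : SDual →L[ℂ] ℂ where
  toFun ξ := pair ξ f
  map_add' ξ η := pair_add ξ η f
  map_smul' c ξ := pair_smul c ξ f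
  cont := by
    let T : SDual →ₗ[ℂ] ℂ :=
      { toFun := fun ξ => pair ξ f
        map_add' := fun ξ η => pair_add ξ η f
        map_smul' := fun c ξ => pair_smul c ξ f }
    refine WithSeminorms.continuous_of_continuous_comp (norm_withSeminorms ℂ ℂ) T fun _ =>
      SDual.continuous_of_admissible fun q => ⟨wnorm q f, fun ξ hξ => ?_⟩
    rw [mul_comm]
    exact norm_pair_le hξ f

/-- The functional `ζ ↦ conj ⟨η, ζ⟩` on `s`. -/
def pairConjCLM (η : SDual) : S →L[ℂ] ℂ where
  toFun ζ := conj (pair η ζ)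
  map_add' ξ ζ := by rw [pair_add_right, map_add]
  map_smul' c ζ := by rw [pair_smul_right, map_mul, Complex.conj_conj]; rfl
  cont := by
    let T : S →ₗ[ℂ] ℂ :=
      { toFun := fun ζ => conj (pair η ζ)
        map_add' := fun ξ ζ => by rw [pair_add_right, map_add]
        map_smul' := fun c ζ => by rw [pair_smul_right, map_mul, Complex.conj_conj]; rfl }
    refine WithSeminorms.continuous_of_continuous_comp (norm_withSeminorms ℂ ℂ) T fun _ => ?_
    obtain ⟨q, hq⟩ := η.2
    have hle : (normSeminorm ℂ ℂ).comp T ≤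
        (show NNReal from ⟨wnorm (-(q : ℤ)) η, wnorm_nonneg _ _⟩) • S.norm q := fun ζ => by
      change ‖conj (pair η ζ)‖ ≤ wnorm (-(q : ℤ)) η * wnorm q ζ
      rw [RCLike.norm_conj]
      exact norm_pair_le hq ζ
    exact Seminorm.continuous_of_le ((S.withSeminorms.continuous_seminorm q).const_smul _) hle

/-- The `j`-th coordinate on `s`. -/
def S.coordCLM (j : ℕ) : S →L[ℂ] ℂ := pairConjCLM (unitVec j)

theorem S.coordCLM_apply (j : ℕ) (ξ : S) : S.coordCLM j ξ = ξ j := by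
  change conj (pair (unitVec j) ξ) = ξ j
  rw [pair_unitVec, Complex.conj_conj]

/-- The coordinates are continuous and separate points. Uniqueness of sums in s and closedness of
commutation relations both depend on this. -/
instance : T2Space S := by
  refine ⟨fun ξ η h => ?_⟩
  obtain ⟨j, hj⟩ : ∃ j, ξ j ≠ η j := by
    by_contra! hc
    exact h (S.ext hc)
  exact separated_by_continuous (S.coordCLM j).continuous
    (by rwa [S.coordCLM_apply, S.coordCLM_apply])

/-! ### Maps between `ℓ₂`, `s` and `s'` -/

/-- The space `ℓ₂`. -/
abbrev L2 : Type := lp (fun _ : ℕ => ℂ) 2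

theorem weight_cancel (r : ℤ) (j : ℕ) (z : ℂ) :
    ((((j : ℝ) + 1) ^ (-r) : ℝ) : ℂ) * (((((j : ℝ) + 1) ^ r : ℝ) : ℂ) * z) = z := by
  have h : ((j : ℝ) + 1) ≠ 0 := by positivity
  have h2 : ((((j : ℝ) + 1) ^ (-r) : ℝ) : ℂ) * ((((j : ℝ) + 1) ^ r : ℝ) : ℂ) = 1 := by
    rw [← Complex.ofReal_mul, ← zpow_add₀ h]
    simp
  rw [← mul_assoc, h2, one_mul]

theorem wsummable_ofL2 (r : ℤ) (a : L2) :
    WSummable (-r) (fun j => ((((j : ℝ) + 1) ^ r : ℝ) : ℂ) * a j) := by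
  apply wsummable_of_memℓp
  simp only [weight_cancel]
  exact a.2

theorem wnorm_ofL2 (r : ℤ) (a : L2) :
    wnorm (-r) (fun j => ((((j : ℝ) + 1) ^ r : ℝ) : ℂ) * a j) = ‖a‖ := by
  rw [← norm_toL2 _ _ (wsummable_ofL2 r a)]
  congr 1
  ext j
  exact weight_cancel r j (a j)

/-- The sequence `((j+1)^r a_j)` for `a ∈ ℓ₂`, as an element of `s'`. -/
def ofL2 (r : ℕ) : L2 →L[ℂ] SDual where
  toFun a := ⟨fun j => ((((j : ℝ) + 1) ^ (r : ℤ) : ℝ) : ℂ) * a j, r, wsummable_ofL2 r a⟩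
  map_add' a b := SDual.ext fun j => mul_add _ (a j) (b j)
  map_smul' c a := SDual.ext fun j => mul_left_comm _ c (a j)
  cont := by
    let T : L2 →ₗ[ℂ] SDual :=
      { toFun := fun a => ⟨fun j => ((((j : ℝ) + 1) ^ (r : ℤ) : ℝ) : ℂ) * a j, r, wsummable_ofL2 r a⟩
        map_add' := fun a b => SDual.ext fun j => mul_add _ (a j) (b j)
        map_smul' := fun c a => SDual.ext fun j => mul_left_comm _ c (a j) }
    refine WithSeminorms.continuous_of_continuous_comp SDual.withSeminorms T fun p => ?_
    obtain ⟨C, hC⟩ := p.2 r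
    have hle : (SDual.seminorms p).comp T ≤ (‖C‖₊ : NNReal) • normSeminorm ℂ L2 := fun a => by
      refine (hC (T a) (wsummable_ofL2 r a)).trans ?_
      refine (congrArg (C * ·) (wnorm_ofL2 r a)).trans_le ?_
      exact mul_le_mul_of_nonneg_right (Real.le_norm_self C) (norm_nonneg _)
    exact Seminorm.continuous_of_le (continuous_norm.const_smul (‖C‖₊ : NNReal)) hle

theorem ofL2_toL2 {r : ℕ} {ξ : SDual} (h : WSummable (-(r : ℤ)) ξ) :
    ofL2 r (toL2 (-(r : ℤ)) ξ h) = ξ :=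
  SDual.ext fun j => by
    have := weight_cancel (-(r : ℤ)) j (ξ j)
    rwa [neg_neg] at this

/-- The unit vector expansion holds in ℓ₂, and the continuous map `ofL2 r` carries it to s' from the
step that contains ξ. -/
theorem SDual.hasSum_unitVec (ξ : SDual) : HasSum (fun i => ξ i • unitVec i) ξ := by
  obtain ⟨r, hr⟩ := ξ.2
  have h := (lp.hasSum_single (p := 2) (by simp) (toL2 (-(r : ℤ)) ξ hr)).mapL (ofL2 r)
  rw [ofL2_toL2] at h
  convert! h using 1
  funext i
  refine SDual.ext fun j => ?_
  rw [SDual.smul_apply]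
  change ξ i * (Pi.single i 1 : ℕ → ℂ) j = _ * (lp.single 2 i _ : L2) j
  by_cases hij : j = i
  · subst hij
    rw [Pi.single_eq_same, lp.single_apply_self, mul_one]
    have := weight_cancel (-(r : ℤ)) j (ξ j)
    rw [neg_neg] at this
    exact this.symm
  · rw [Pi.single_eq_of_ne hij, lp.single_apply_ne _ _ _ hij, mul_zero, mul_zero]

theorem LSS.hasSum_apply (x : LSS) (ξ : SDual) : HasSum (fun i => ξ i • x (unitVec i)) (x ξ) := by
  have h := (SDual.hasSum_unitVec ξ).mapL (show SDual →L[ℂ] S from x)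
  convert! h using 1
  funext i
  exact (LSS.map_smul x _ _).symm

theorem LSS.ext_unitVec {x y : LSS} (h : ∀ i, x (unitVec i) = y (unitVec i)) : x = y :=
  LSS.ext fun ξ => (x.hasSum_apply ξ).unique (by simpa only [h] using y.hasSum_apply ξ)

/-! ### The hermitian adjoint -/

theorem LSS.star_apply (x : LSS) (ξ : SDual) (i : ℕ) :
    (star x : LSS) ξ i = pair ξ (x (unitVec i)) := rfl

/-- The adjoint is defined through its coordinates only. Expanding ξ in unit vectors turns both
sides into sums of the same series. -/
theorem pair_star (x : LSS) (ξ η : SDual) : pair ξ ((star x : LSS) η) = conj (pair η (x ξ)) := by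
  have h1 := (SDual.hasSum_unitVec ξ).mapL (pairCLM ((star x : LSS) η))
  have h2 := (x.hasSum_apply ξ).mapL (pairConjCLM η)
  refine h1.unique ?_
  convert! h2 using 1
  funext i
  change pair (ξ i • unitVec i) _ = conj (pair η (ξ i • x (unitVec i)))
  rw [pair_smul, pair_smul_right, pair_unitVec, LSS.star_apply, map_mul, Complex.conj_conj]

theorem pair_apply (x : LSS) (ξ : SDual) (η : S) :
    pair (incl (x ξ)) η = pair ξ ((star x : LSS) (incl η)) := by
  rw [pair_star, pair_incl_conj]

theorem S.ext_pair {ξ η : S} (h : ∀ ζ : SDual, pair ζ ξ = pair ζ η) : ξ = η :=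
  S.ext fun j => by
    have h1 := h (unitVec j)
    rw [pair_unitVec, pair_unitVec] at h1
    exact (starRingEnd ℂ).injective h1

theorem LSS.star_star (x : LSS) : star (star x : LSS) = x :=
  LSS.ext fun ξ => S.ext_pair fun ζ => by rw [pair_star, pair_star, Complex.conj_conj]

theorem LSS.star_mul (x y : LSS) : star (x * y) = (star y * star x : LSS) :=
  LSS.ext fun ξ => S.ext_pair fun ζ => by
    rw [pair_star, LSS.mul_apply, LSS.mul_apply, pair_star, pair_incl_conj, ← pair_star]

theorem LSS.star_add (x y : LSS) : star (x + y) = (star x + star y : LSS) :=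
  LSS.ext fun ξ => S.ext fun i => pair_add_right ξ (x (unitVec i)) (y (unitVec i))

theorem LSS.star_smul (c : ℂ) (x : LSS) : star (c • x) = (conj c • star x : LSS) :=
  LSS.ext fun ξ => S.ext fun i => pair_smul_right c ξ (x (unitVec i))

/-! ### Maximal commutative subalgebras are their own centralizers -/

theorem LSS.smul_mul (c : ℂ) (x y : LSS) : (c • x) * y = c • (x * y) := rfl

theorem LSS.mul_smul (c : ℂ) (x y : LSS) : x * (c • y) = c • (x * y) :=
  LSS.ext fun ξ => by
    change x (incl (c • y ξ)) = c • x (incl (y ξ))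
    rw [_root_.map_smul, LSS.map_smul]

theorem LSS.continuous_eval (ξ : SDual) : Continuous fun x : LSS => x ξ :=
  continuous_eval_const (F := SDual →L[ℂ] S) ξ

theorem LSS.continuous_apply (x : LSS) : Continuous x :=
  (show SDual →L[ℂ] S from x).continuous

/-- Evaluation at a vector is continuous, so every relation y x ξ = x y ξ cuts out a closed set of
operators x. -/
theorem LSS.isClosed_centralizer (A : Set LSS) : IsClosed A.centralizer := by
  have h : A.centralizer = ⋂ y ∈ A, ⋂ ξ : SDual, {x : LSS | y (incl (x ξ)) = x (incl (y ξ))} := by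
    ext x
    simp only [Set.mem_centralizer_iff, Set.mem_iInter, Set.mem_ofPred_eq]
    exact forall₂_congr fun y _ => ⟨fun h ξ => DFunLike.congr_fun h ξ, fun h => LSS.ext h⟩
  rw [h]
  exact isClosed_biInter fun y _ => isClosed_iInter fun ξ => isClosed_eq
    (y.continuous_apply.comp (incl.continuous.comp (LSS.continuous_eval ξ)))
    (LSS.continuous_eval _)

/-- The centralizer of a self-adjoint set of operators. -/
def starCentralizer (A : Set LSS) (hA : ∀ x ∈ A, star x ∈ A) : NonUnitalStarSubalgebra ℂ LSS where
  carrier := A.centralizer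
  add_mem' := Set.add_mem_centralizer
  zero_mem' := Set.zero_mem_centralizer
  mul_mem' := Set.mul_mem_centralizer
  smul_mem' c x hx y hy := by rw [LSS.mul_smul, LSS.smul_mul, hx y hy]
  star_mem' := by
    intro x hx y hy
    have h := congrArg star (hx _ (hA y hy))
    rw [LSS.star_mul, LSS.star_mul, LSS.star_star] at h
    exact h.symm

/-- A star subalgebra that is its own centralizer. -/
def IsSelfCentralizing (E : NonUnitalStarSubalgebra ℂ LSS) : Prop :=
  ∀ x : LSS, x ∈ E ↔ ∀ y ∈ E, y * x = x * y

/-- Adjoin a self-adjoint commuting operator and pass to the bicommutant, which maximality forces to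
be E. A general commuting operator is split into its real and imaginary parts, which commute with E
because E is self-adjoint. -/
theorem IsClosedMaximalCommutative.isSelfCentralizing {E : NonUnitalStarSubalgebra ℂ LSS}
    (hE : IsClosedMaximalCommutative E) : IsSelfCentralizing E := by
  have key : ∀ a : LSS, star a = a → (∀ y ∈ E, y * a = a * y) → a ∈ E := by
    intro a ha hc
    -- Self-adjointness of a keeps this set closed under the involution, so that its bicommutant is
    -- a `*`-subalgebra; it is commutative because the set is.
    let A : Set LSS := insert a (E : Set LSS)
    have hA : ∀ x ∈ A, star x ∈ A := by
      rintro x (rfl | hx)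
      · rw [ha]; exact Or.inl rfl
      · exact Or.inr (star_mem hx)
    have hcomm : ∀ x ∈ A, ∀ y ∈ A, x * y = y * x := by
      rintro x (rfl | hx) y (rfl | hy)
      · rfl
      · exact (hc y hy).symm
      · exact hc x hx
      · exact hE.1.2 x hx y hy
    let F := starCentralizer A.centralizer fun x hx =>
      (starCentralizer A hA).star_mem' hx
    have hAF : ∀ x ∈ A, x ∈ F := fun x hx => Set.subset_centralizer_centralizer hx
    have hF : F = E := hE.2 F
      ⟨LSS.isClosed_centralizer _, fun x hx y hy =>
        Set.centralizer_centralizer_comm_of_comm hcomm x hx y hy⟩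
      fun x hx => hAF x (Or.inr hx)
    rw [← hF]
    exact hAF a (Or.inl rfl)
  refine fun x => ⟨fun hx y hy => hE.1.2 y hy x hx, fun hc => ?_⟩
  have hc' : ∀ y ∈ E, y * star x = star x * y := fun y hy => by
    have h := congrArg star (hc _ (star_mem hy))
    rw [LSS.star_mul, LSS.star_mul, LSS.star_star] at h
    exact h.symm
  have h1 : x + star x ∈ E := key _ (by rw [LSS.star_add, LSS.star_star, add_comm]) fun y hy => by
    rw [mul_add, add_mul, hc y hy, hc' y hy]
  have h2 : Complex.I • (x + (-1 : ℂ) • star x) ∈ E := key _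
    (by
      rw [LSS.star_smul, LSS.star_add, LSS.star_smul, LSS.star_star]
      simp only [Complex.conj_I, map_neg, map_one, smul_add, smul_smul]
      rw [add_comm]
      congr 2 <;> ring) fun y hy => by
    rw [LSS.mul_smul, LSS.smul_mul, mul_add, add_mul, LSS.mul_smul, LSS.smul_mul, hc y hy,
      hc' y hy]
  -- Here x = ½ ((x + x*) − i · i (x − x*)).
  have h3 := E.smul_mem (2 : ℂ)⁻¹ (add_mem h1 (E.smul_mem (-Complex.I) h2))
  have h4 : -Complex.I * Complex.I = 1 := by simp
  rw [smul_smul, h4, one_smul] at h3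
  convert! h3 using 1
  module

theorem IsSelfCentralizing.isClosedMaximalCommutative {E : NonUnitalStarSubalgebra ℂ LSS}
    (hE : IsSelfCentralizing E) : IsClosedMaximalCommutative E := by
  refine ⟨⟨?_, fun x hx y hy => (hE y).1 hy x hx⟩, fun F hF hEF => le_antisymm (fun x hx => ?_) hEF⟩
  · have : (E : Set LSS) = (E : Set LSS).centralizer := Set.ext fun x => hE x
    rw [this]
    exact LSS.isClosed_centralizer _
  · exact (hE x).2 fun y hy => hF.2 y (hEF hy) x hx

/-! ### Bounded subsets of `s'` -/

theorem SDual.isVonNBounded_ball (r : ℕ) (C : ℝ) :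
    Bornology.IsVonNBounded ℂ {ξ : SDual | WSummable (-(r : ℤ)) ξ ∧ wnorm (-(r : ℤ)) ξ ≤ C} := by
  refine (SDual.withSeminorms.isVonNBounded_iff_seminorm_bounded).2 fun p => ?_
  obtain ⟨D, hD⟩ := p.2 r
  refine ⟨|D| * |C| + 1, by positivity, fun ξ hξ => ?_⟩
  refine lt_of_le_of_lt ((hD ξ hξ.1).trans ?_) (lt_add_one _)
  have h0 := wnorm_nonneg (-(r : ℤ)) ξ
  exact mul_le_mul (le_abs_self D) (hξ.2.trans (le_abs_self C)) h0 (abs_nonneg _)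

theorem wsummable_norm {q : ℤ} {ξ : ℕ → ℂ} (h : WSummable q ξ) :
    WSummable q (fun j => ((‖ξ j‖ : ℝ) : ℂ)) := by
  simpa [WSummable] using h

theorem wnorm_norm (q : ℤ) (ξ : ℕ → ℂ) : wnorm q (fun j => ((‖ξ j‖ : ℝ) : ℂ)) = wnorm q ξ := by
  simp [wnorm]

theorem summable_norm_mul_norm {q : ℕ} {ξ : ℕ → ℂ} (hξ : WSummable (-(q : ℤ)) ξ) (a : S) :
    Summable fun j => ‖ξ j‖ * ‖a j‖ := by
  have h := summable_pairing (wsummable_norm hξ) (wsummable_norm (a.2 q))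
  simp only [Complex.conj_ofReal, ← Complex.ofReal_mul] at h
  exact Complex.summable_ofReal.1 h

theorem tsum_norm_mul_norm_le {q : ℕ} {ξ : ℕ → ℂ} (hξ : WSummable (-(q : ℤ)) ξ) (a : S) :
    ∑' j, ‖ξ j‖ * ‖a j‖ ≤ wnorm (-(q : ℤ)) ξ * wnorm q a := by
  have h := norm_pairing_le (wsummable_norm hξ) (wsummable_norm (a.2 q))
  simp only [Complex.conj_ofReal, ← Complex.ofReal_mul, wnorm_norm, ← Complex.ofReal_tsum,
    Complex.norm_real] at h
  exact (Real.le_norm_self _).trans h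

/-- The seminorm `∑ |ξ_j| |a_j|` on `s'`. -/
def SDual.absPair (a : S) : Seminorm ℂ SDual :=
  Seminorm.of (fun ξ : SDual => ∑' j, ‖ξ j‖ * ‖a j‖)
    (fun ξ η => by
      obtain ⟨q, hq⟩ := ξ.2
      obtain ⟨r, hr⟩ := η.2
      obtain ⟨t, ht⟩ := (ξ + η).2
      have h1 := summable_norm_mul_norm hq a
      have h2 := summable_norm_mul_norm hr a
      rw [← h1.tsum_add h2]
      refine (summable_norm_mul_norm ht a).tsum_le_tsum (fun j => ?_) (h1.add h2)
      rw [← add_mul]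
      exact mul_le_mul_of_nonneg_right (norm_add_le (ξ j) (η j)) (norm_nonneg _))
    (fun c ξ => by
      rw [← tsum_mul_left]
      refine tsum_congr fun j => ?_
      rw [SDual.smul_apply, norm_mul, mul_assoc])

theorem SDual.admissible_absPair (a : S) : SDual.Admissible (SDual.absPair a) := fun q =>
  ⟨wnorm q a, fun ξ hξ => by
    rw [mul_comm]
    exact tsum_norm_mul_norm_le hξ a⟩

theorem SDual.norm_mul_norm_le_absPair (a : S) (ξ : SDual) (j : ℕ) :
    ‖ξ j‖ * ‖a j‖ ≤ SDual.absPair a ξ := by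
  obtain ⟨q, hq⟩ := ξ.2
  exact (summable_norm_mul_norm hq a).le_tsum j fun i _ => by positivity

/-- From n = q on the exponent is nonpositive, so a geometric series dominates whatever the indices
are. -/
theorem summable_hump (i : ℕ → ℕ) (q : ℕ) :
    Summable fun n : ℕ => (2⁻¹ : ℝ) ^ n * ((i n : ℝ) + 1) ^ ((q : ℤ) - n) := by
  refine Summable.of_norm_bounded_eventually_nat (g := fun n => (2⁻¹ : ℝ) ^ n)
    (summable_geometric_of_lt_one (by norm_num) (by norm_num)) ?_
  filter_upwards [Filter.eventually_ge_atTop q] with n hn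
  have h1 : (1 : ℝ) ≤ (i n : ℝ) + 1 := by simp
  rw [Real.norm_of_nonneg (by positivity)]
  refine mul_le_of_le_one_right (by positivity) ?_
  exact zpow_le_one_of_nonpos₀ h1 (by omega)

/-- For every sequence of indices `i_n` there is `a ∈ s` with `a_{i_n} ≥ 2^{-n} (i_n+1)^{-n}`. -/
theorem S.exists_hump (i : ℕ → ℕ) :
    ∃ a : S, ∀ n : ℕ, (2⁻¹ : ℝ) ^ n * ((i n : ℝ) + 1) ^ (-(n : ℤ)) ≤ ‖a (i n)‖ := by
  -- The indices may repeat, so the j-th coordinate collects the contributions of all n with i_n =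
  -- j.
  let c : ℕ → ℕ → ℝ := fun j n => if i n = j then (2⁻¹ : ℝ) ^ n * ((i n : ℝ) + 1) ^ (-(n : ℤ)) else 0
  have hc0 : ∀ j n, 0 ≤ c j n := fun j n => by
    simp only [c]; split_ifs <;> positivity
  have hcs : ∀ j, Summable (c j) := fun j => by
    refine Summable.of_nonneg_of_le (hc0 j) (fun n => ?_) (summable_hump i 0)
    simp only [c]; split_ifs
    · simp
    · positivity
  -- When i_n = j, the factor (j+1)^{-(q+1)} splits off; dropping the restriction i_n = j afterwards
  -- leaves a constant independent of j.
  have hb : ∀ (q j : ℕ), ‖((∑' n, c j n : ℝ) : ℂ)‖ ≤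
      (∑' n : ℕ, (2⁻¹ : ℝ) ^ n * ((i n : ℝ) + 1) ^ (((q + 1 : ℕ) : ℤ) - n)) *
        ((j : ℝ) + 1) ^ (-((q : ℤ) + 1)) := fun q j => by
    have hj : ((j : ℝ) + 1) ≠ 0 := by positivity
    rw [Complex.norm_real, Real.norm_of_nonneg (tsum_nonneg (hc0 j)), ← tsum_mul_right]
    refine (hcs j).tsum_le_tsum (fun n => ?_) ((summable_hump i (q + 1)).mul_right _)
    simp only [c]; split_ifs with h
    · rw [h, mul_assoc, ← zpow_add₀ hj]
      apply le_of_eq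
      congr 2
      push_cast
      ring
    · positivity
  refine ⟨⟨fun j => ((∑' n, c j n : ℝ) : ℂ), fun q => (wsummable_of_bound (hb q)).1⟩, fun n => ?_⟩
  change _ ≤ ‖((∑' m, c (i n) m : ℝ) : ℂ)‖
  rw [Complex.norm_real, Real.norm_of_nonneg (tsum_nonneg (hc0 _))]
  refine le_trans (le_of_eq ?_) ((hcs (i n)).le_tsum n fun m _ => hc0 _ m)
  simp [c]

/-- Passing to the step n + 1 gains the factor (j+1)^{-2} in the squared terms, which makes them
summable. -/
theorem wnorm_le_of_growth {n : ℕ} {D : ℝ} {ξ : ℕ → ℂ}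
    (h : ∀ j : ℕ, ‖ξ j‖ ≤ D * ((j : ℝ) + 1) ^ n) :
    WSummable (-((n + 1 : ℕ) : ℤ)) ξ ∧
      wnorm (-((n + 1 : ℕ) : ℤ)) ξ ≤ D * Real.sqrt (∑' j : ℕ, ((j : ℝ) + 1) ^ (-2 : ℤ)) := by
  have hD : 0 ≤ D := by simpa using (norm_nonneg _).trans (h 0)
  have hle : ∀ j : ℕ, ‖ξ j‖ ^ 2 * ((j : ℝ) + 1) ^ (2 * (-((n + 1 : ℕ) : ℤ)))
      ≤ D ^ 2 * ((j : ℝ) + 1) ^ (-2 : ℤ) := fun j => by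
    have hj : ((j : ℝ) + 1) ≠ 0 := by positivity
    calc ‖ξ j‖ ^ 2 * ((j : ℝ) + 1) ^ (2 * (-((n + 1 : ℕ) : ℤ)))
        ≤ (D * ((j : ℝ) + 1) ^ n) ^ 2 * ((j : ℝ) + 1) ^ (2 * (-((n + 1 : ℕ) : ℤ))) := by
          gcongr
          exact h j
      _ = D ^ 2 * ((j : ℝ) + 1) ^ (-2 : ℤ) := by
          rw [mul_pow, mul_assoc, ← pow_mul, ← zpow_natCast _ (n * 2), ← zpow_add₀ hj]
          congr 2
          push_cast
          ring
  have hs := summable_inv_sq.mul_left (D ^ 2)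
  have hw : WSummable (-((n + 1 : ℕ) : ℤ)) ξ :=
    Summable.of_nonneg_of_le (fun j => by positivity) hle hs
  refine ⟨hw, ?_⟩
  have h2 := Real.sqrt_le_sqrt (hw.tsum_le_tsum hle hs)
  rwa [tsum_mul_left, Real.sqrt_mul (by positivity), Real.sqrt_sq hD] at h2

/-- Every bounded subset of `s'` is contained and bounded in one of the steps. -/
theorem SDual.exists_step_of_isVonNBounded {B : Set SDual} (hB : Bornology.IsVonNBounded ℂ B) :
    ∃ (r : ℕ) (C : ℝ), ∀ ξ ∈ B, WSummable (-(r : ℤ)) ξ ∧ wnorm (-(r : ℤ)) ξ ≤ C := by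
  suffices h : ∃ n : ℕ, ∀ ξ ∈ B, ∀ j, ‖ξ j‖ ≤ (n * 2 ^ n : ℝ) * ((j : ℝ) + 1) ^ n by
    obtain ⟨n, hn⟩ := h
    exact ⟨n + 1, _, fun ξ hξ => wnorm_le_of_growth (hn ξ hξ)⟩
  -- Otherwise for each n some ξ_n in B has a coordinate i_n exceeding n 2ⁿ (i_n+1)ⁿ. The hump
  -- vector a cancels all but the factor n there, so the admissible seminorm ∑ |ξ_j| |a_j| is
  -- unbounded on B.
  by_contra! hcon
  choose ξ hξ i hi using hcon
  obtain ⟨a, ha⟩ := S.exists_hump i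
  obtain ⟨R, hR, hlt⟩ := (SDual.withSeminorms.isVonNBounded_iff_seminorm_bounded).1 hB
    ⟨SDual.absPair a, SDual.admissible_absPair a⟩
  obtain ⟨n, hn⟩ := exists_nat_ge R
  have h1 := hlt (ξ n) (hξ n)
  have h2 := SDual.norm_mul_norm_le_absPair a (ξ n) (i n)
  have hj : (0 : ℝ) < ((i n : ℝ) + 1) ^ n := by positivity
  have h3 : (n : ℝ) ≤ ‖ξ n (i n)‖ * ‖a (i n)‖ := by
    calc (n : ℝ) = (n * 2 ^ n * ((i n : ℝ) + 1) ^ n) *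
          ((2⁻¹ : ℝ) ^ n * ((i n : ℝ) + 1) ^ (-(n : ℤ))) := by
          rw [zpow_neg, zpow_natCast, inv_pow]
          field_simp
      _ ≤ _ := mul_le_mul (hi n).le (ha n) (by positivity) (norm_nonneg _)
  have h4 : SDual.absPair a (ξ n) < R := h1
  linarith

section

/-! ### The embedding of `s` into `ℓ₂` -/

/-- The embedding of `s` into `ℓ₂`. -/
def S.toL2 : S →L[ℂ] L2 where
  toFun ξ := ⟨fun j => ξ j, by
    have h := (SmoothOp.toL2 0 ξ (ξ.2 0)).2
    simpa [SmoothOp.toL2] using h⟩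
  map_add' _ _ := rfl
  map_smul' _ _ := rfl
  cont := by
    let T : S →ₗ[ℂ] L2 :=
      { toFun := fun ξ => ⟨fun j => ξ j, by
          have h := (SmoothOp.toL2 0 ξ (ξ.2 0)).2
          simpa [SmoothOp.toL2] using h⟩
        map_add' := fun _ _ => rfl
        map_smul' := fun _ _ => rfl }
    refine WithSeminorms.continuous_of_continuous_comp (norm_withSeminorms ℂ L2) T fun _ => ?_
    have hle : (normSeminorm ℂ L2).comp T ≤ S.norm 0 := fun ξ => by
      refine le_of_eq (Eq.trans ?_ (norm_toL2 0 ξ (ξ.2 0)))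
      change ‖T ξ‖ = _
      congr 1
      ext j
      change ξ j = (((((j : ℝ) + 1) ^ (0 : ℤ) : ℝ)) : ℂ) * ξ j
      simp
    exact Seminorm.continuous_of_le (S.withSeminorms.continuous_seminorm 0) hle

theorem S.toL2_apply (ξ : S) (j : ℕ) : S.toL2 ξ j = ξ j := rfl

theorem S.toL2_injective : Function.Injective S.toL2 := fun ξ η h =>
  S.ext fun j => by rw [← S.toL2_apply, h, S.toL2_apply]

theorem inner_toL2 (ξ η : S) : inner ℂ (S.toL2 ξ) (S.toL2 η) = pair (incl η) ξ := by
  rw [lp.inner_eq_tsum]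
  exact tsum_congr fun j => by rw [RCLike.inner_apply]; rfl

theorem norm_toL2_sq (ξ : S) : ((‖S.toL2 ξ‖ ^ 2 : ℝ) : ℂ) = pair (incl ξ) ξ := by
  rw [← inner_toL2, inner_self_eq_norm_sq_to_K]
  simp

theorem pair_self_ne_zero {ξ : S} (h : ξ ≠ 0) : pair (incl ξ) ξ ≠ 0 := by
  rw [← norm_toL2_sq]
  have : S.toL2 ξ ≠ 0 := fun h0 => h (S.toL2_injective (by rw [h0, map_zero]))
  exact_mod_cast pow_ne_zero 2 (norm_ne_zero_iff.2 this)

theorem orthonormal_toL2 {ι : Type*} [DecidableEq ι] {f : ι → S}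
    (hf : ∀ k l, pair (incl (f k)) (f l) = if k = l then 1 else 0) :
    Orthonormal ℂ fun k => S.toL2 (f k) := by
  rw [orthonormal_iff_ite]
  intro k l
  rw [inner_toL2, hf]
  simp only [eq_comm]

theorem inner_toL2_single (ξ : S) (j : ℕ) :
    inner ℂ (S.toL2 ξ) (lp.single 2 j (1 : ℂ) : L2) = conj (ξ j) := by
  rw [lp.inner_single_right, RCLike.inner_apply, one_mul]
  rfl

/-! ### Norm estimates for orthonormal sequences -/

theorem wnorm_sq (q : ℤ) (ξ : ℕ → ℂ) :
    wnorm q ξ ^ 2 = ∑' j : ℕ, ‖ξ j‖ ^ 2 * ((j : ℝ) + 1) ^ (2 * q) :=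
  Real.sq_sqrt (tsum_nonneg fun j => by positivity)

/-- Logarithmic convexity of the norms: the Cauchy–Schwarz inequality for the sequence weighted with
the exponents a and b. -/
theorem wnorm_sq_le_mul {a b c : ℤ} (h : a + b = 2 * c) {ξ : ℕ → ℂ} (ha : WSummable a ξ)
    (hb : WSummable b ξ) : wnorm c ξ ^ 2 ≤ wnorm a ξ * wnorm b ξ := by
  have h1 : inner ℂ (toL2 a ξ ha) (toL2 b ξ hb) = ((wnorm c ξ ^ 2 : ℝ) : ℂ) := by
    rw [lp.inner_eq_tsum, wnorm_sq, Complex.ofReal_tsum]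
    refine tsum_congr fun j => ?_
    have hj : ((j : ℝ) + 1) ≠ 0 := by positivity
    change inner ℂ ((((((j : ℝ) + 1) ^ a : ℝ)) : ℂ) * ξ j) ((((((j : ℝ) + 1) ^ b : ℝ)) : ℂ) * ξ j)
      = _
    rw [RCLike.inner_apply, map_mul, Complex.conj_ofReal, ← h, zpow_add₀ hj, Complex.ofReal_mul,
      Complex.ofReal_mul, Complex.ofReal_pow, ← Complex.mul_conj']
    ring
  have h2 := norm_inner_le_norm (𝕜 := ℂ) (toL2 a ξ ha) (toL2 b ξ hb)
  rw [h1, norm_toL2, norm_toL2, Complex.norm_real, Real.norm_of_nonneg (by positivity)] at h2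
  exact h2

variable (f : OrthonormalSeq)

theorem OrthonormalSeq.wnorm_zero (k : ℕ) : wnorm 0 (f k) = 1 := by
  have h1 : pair (incl (f k)) (f k) = ((wnorm 0 (f k) ^ 2 : ℝ) : ℂ) := by
    rw [wnorm_sq, Complex.ofReal_tsum]
    refine tsum_congr fun j => ?_
    simp [incl_apply, Complex.mul_conj']
  rw [f.orthonormal, if_pos rfl] at h1
  have h2 : wnorm 0 (f k) ^ 2 = 1 := by exact_mod_cast h1.symm
  exact (pow_eq_one_iff_of_nonneg (wnorm_nonneg _ _) two_ne_zero).1 h2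

theorem OrthonormalSeq.norm_sq_le (k q : ℕ) : S.norm q (f k) ^ 2 ≤ S.norm (2 * q) (f k) := by
  have h := wnorm_sq_le_mul (a := 0) (b := ((2 * q : ℕ) : ℤ)) (c := q) (by push_cast; ring)
    ((f k).2 0) ((f k).2 (2 * q))
  rwa [f.wnorm_zero, one_mul] at h

theorem OrthonormalSeq.norm_mono (k : ℕ) {q r : ℕ} (h : q ≤ r) :
    S.norm q (f k) ≤ S.norm r (f k) :=
  wnorm_mono (by exact_mod_cast h) ((f k).2 r)

theorem OrthonormalSeq.norm_pos (k q : ℕ) : 0 < S.norm q (f k) :=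
  zero_lt_one.trans_le (f.one_le_norm k q)

/-- Bessel's inequality for the j-th unit vector of ℓ₂. -/
theorem OrthonormalSeq.sum_coord_le (s : Finset ℕ) (j : ℕ) : ∑ k ∈ s, ‖f k j‖ ^ 2 ≤ 1 := by
  have h := (orthonormal_toL2 f.orthonormal).sum_inner_products_le
    (lp.single 2 j (1 : ℂ) : L2) (s := s)
  simpa [inner_toL2_single, lp.norm_single] using h

/-- Convexity gives 1 = |f_k|_0² ≤ |f_k|_1 |f_k|'_1. Summing |f_k|'_1² over k first and using Bessel
in each coordinate bounds the total by ∑ (j+1)^{-2}. -/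
theorem OrthonormalSeq.summable_inv_norm_sq : Summable fun k => (S.norm 1 (f k) ^ 2)⁻¹ := by
  have hws : ∀ k, WSummable (-1) (f k) := fun k => ((f k).2 0).mono (by simp)
  have h1 : Summable fun k => wnorm (-1) (f k) ^ 2 := by
    refine summable_of_sum_le (c := ∑' j : ℕ, ((j : ℝ) + 1) ^ (-2 : ℤ)) (fun k => by positivity)
      fun s => ?_
    simp only [wnorm_sq]
    rw [← Summable.tsum_finsetSum fun k _ => hws k]
    refine (summable_sum fun k _ => hws k).tsum_le_tsum (fun j => ?_) summable_inv_sq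
    rw [← Finset.sum_mul]
    exact mul_le_of_le_one_left (by positivity) (f.sum_coord_le s j)
  refine Summable.of_nonneg_of_le (fun k => by positivity) (fun k => ?_) h1
  have h2 := wnorm_sq_le_mul (a := 1) (b := -1) (c := 0) (by norm_num) ((f k).2 1) (hws k)
  rw [f.wnorm_zero, one_pow] at h2
  have h3 := f.norm_pos k 1
  rw [← inv_pow]
  gcongr
  rw [inv_le_iff_one_le_mul₀' h3]
  exact h2

/-- All four factors on the left, counting |f_k|_1 twice, are at most |f_k|_m, and two applications
of |f_k|_m² ≤ |f_k|_{2m} absorb the fourth power. The gained factor |f_k|_1^{-2} is summable in k.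
-/
theorem OrthonormalSeq.norm_mul_norm_le (k : ℕ) {q r m : ℕ} (hq : q ≤ m) (hr : r ≤ m)
    (hm : 1 ≤ m) :
    S.norm r (f k) * S.norm q (f k) ≤ S.norm (4 * m) (f k) * (S.norm 1 (f k) ^ 2)⁻¹ := by
  have h0 := f.norm_pos k 1
  rw [← div_eq_mul_inv, le_div_iff₀ (by positivity)]
  have h1 := f.norm_sq_le k m
  have h2 := f.norm_sq_le k (2 * m)
  rw [show 2 * (2 * m) = 4 * m by ring] at h2
  have hp := f.norm_pos k m
  calc S.norm r (f k) * S.norm q (f k) * S.norm 1 (f k) ^ 2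
      ≤ S.norm m (f k) * S.norm m (f k) * S.norm m (f k) ^ 2 := by
        gcongr
        · exact f.norm_mono k hr
        · exact f.norm_mono k hq
        · exact f.norm_mono k hm
    _ = (S.norm m (f k) ^ 2) ^ 2 := by ring
    _ ≤ S.norm (2 * m) (f k) ^ 2 := by gcongr
    _ ≤ _ := h2

/-! ### Diagonal operators -/

theorem LambdaInf.norm_mul_le (A : KotheMatrix) [A.IsAlgebra] (ξ : LambdaInf A) (k q : ℕ) :
    ‖ξ.1 k‖ * A.entry k q ≤ LambdaInf.norm A q ξ :=
  le_ciSup (ξ.2 q) k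

/-- The constant `∑_k |f_k|_1^{-2}`. -/
def OrthonormalSeq.bound : ℝ := ∑' k, (S.norm 1 (f k) ^ 2)⁻¹

variable {f}

theorem diag_term_le (ξ : LambdaInf f.matrix) {q r : ℕ} {η : SDual} (hη : WSummable (-(r : ℤ)) η)
    (j k : ℕ) :
    ‖ξ.1 k * pair η (f k) * f k j‖ ≤
      LambdaInf.norm f.matrix (4 * (q + r + 1)) ξ * wnorm (-(r : ℤ)) η *
        ((j : ℝ) + 1) ^ (-((q : ℤ) + 1)) * (S.norm 1 (f k) ^ 2)⁻¹ := by
  have hj : (0 : ℝ) < (j : ℝ) + 1 := by positivity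
  have h1 := norm_pair_le hη (f k)
  have h2 : ‖f k j‖ ≤ S.norm (q + 1) (f k) * ((j : ℝ) + 1) ^ (-((q : ℤ) + 1)) := by
    rw [zpow_neg, ← div_eq_mul_inv, le_div_iff₀ (by positivity)]
    exact norm_coord_le ((f k).2 (q + 1)) j
  have h3 := LambdaInf.norm_mul_le f.matrix ξ k (4 * (q + r + 1))
  -- The level q + 1 supplies the decay (j+1)^{-(q+1)} needed for a finite q-norm, and m = q + r + 1
  -- dominates q + 1, r and 1.
  have h4 := f.norm_mul_norm_le k (q := q + 1) (r := r) (m := q + r + 1) (by omega) (by omega)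
    (by omega)
  have h5 := f.norm_pos k 1
  have hw := wnorm_nonneg (-(r : ℤ)) η
  have hn : 0 ≤ S.norm (q + 1) (f k) := (f.norm_pos k _).le
  rw [norm_mul, norm_mul]
  calc ‖ξ.1 k‖ * ‖pair η (f k)‖ * ‖f k j‖
      ≤ ‖ξ.1 k‖ * (wnorm (-(r : ℤ)) η * S.norm r (f k)) *
          (S.norm (q + 1) (f k) * ((j : ℝ) + 1) ^ (-((q : ℤ) + 1))) := by
        gcongr
        exact h1
    _ = ‖ξ.1 k‖ * (S.norm r (f k) * S.norm (q + 1) (f k)) * wnorm (-(r : ℤ)) η *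
          ((j : ℝ) + 1) ^ (-((q : ℤ) + 1)) := by ring
    _ ≤ ‖ξ.1 k‖ * (S.norm (4 * (q + r + 1)) (f k) * (S.norm 1 (f k) ^ 2)⁻¹) *
          wnorm (-(r : ℤ)) η * ((j : ℝ) + 1) ^ (-((q : ℤ) + 1)) := by gcongr
    _ = (‖ξ.1 k‖ * S.norm (4 * (q + r + 1)) (f k)) * (wnorm (-(r : ℤ)) η *
          ((j : ℝ) + 1) ^ (-((q : ℤ) + 1)) * (S.norm 1 (f k) ^ 2)⁻¹) := by ring
    _ ≤ LambdaInf.norm f.matrix (4 * (q + r + 1)) ξ * (wnorm (-(r : ℤ)) η *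
          ((j : ℝ) + 1) ^ (-((q : ℤ) + 1)) * (S.norm 1 (f k) ^ 2)⁻¹) := by
        gcongr
        exact h3
    _ = _ := by ring

theorem summable_diag (ξ : LambdaInf f.matrix) (η : SDual) (j : ℕ) :
    Summable fun k => ξ.1 k * pair η (f k) * f k j := by
  obtain ⟨r, hr⟩ := η.2
  exact Summable.of_norm_bounded (f.summable_inv_norm_sq.mul_left _)
    fun k => diag_term_le (q := 0) ξ hr j k

theorem norm_diag_le (ξ : LambdaInf f.matrix) {q r : ℕ} {η : SDual} (hη : WSummable (-(r : ℤ)) η)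
    (j : ℕ) :
    ‖∑' k, ξ.1 k * pair η (f k) * f k j‖ ≤
      (LambdaInf.norm f.matrix (4 * (q + r + 1)) ξ * wnorm (-(r : ℤ)) η * f.bound) *
        ((j : ℝ) + 1) ^ (-((q : ℤ) + 1)) := by
  have h := tsum_of_norm_bounded (f.summable_inv_norm_sq.hasSum.mul_left _)
    fun k => diag_term_le (q := q) ξ hη j k
  refine h.trans (le_of_eq ?_)
  rw [OrthonormalSeq.bound]
  ring

/-- The value `∑ ξ_k ⟨η, f_k⟩ f_k`. -/
def diagFun (ξ : LambdaInf f.matrix) (η : SDual) : S :=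
  ⟨fun j => ∑' k, ξ.1 k * pair η (f k) * f k j, fun q => by
    obtain ⟨r, hr⟩ := η.2
    exact (wsummable_of_bound (norm_diag_le ξ hr)).1⟩

theorem wnorm_diagFun_le (ξ : LambdaInf f.matrix) {q r : ℕ} {η : SDual}
    (hη : WSummable (-(r : ℤ)) η) :
    wnorm q (diagFun ξ η) ≤ LambdaInf.norm f.matrix (4 * (q + r + 1)) ξ * wnorm (-(r : ℤ)) η *
      f.bound * Real.sqrt (∑' j : ℕ, ((j : ℝ) + 1) ^ (-2 : ℤ)) :=
  (wsummable_of_bound (norm_diag_le ξ hη)).2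

/-- The operator `∑ ξ_k ⟨·, f_k⟩ f_k`. -/
def diag (ξ : LambdaInf f.matrix) : LSS :=
  SDual.mkCLM
    { toFun := diagFun ξ
      map_add' := fun η η' => S.ext fun j => by
        rw [S.add_apply]
        change ∑' k, _ = ∑' k, _ + ∑' k, _
        rw [← (summable_diag ξ η j).tsum_add (summable_diag ξ η' j)]
        exact tsum_congr fun k => by rw [pair_add]; ring
      map_smul' := fun c η => S.ext fun j => by
        rw [RingHom.id_apply, S.smul_apply]
        change ∑' k, _ = c * ∑' k, _
        rw [← tsum_mul_left]
        exact tsum_congr fun k => by rw [pair_smul]; ring }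
    (fun q r => ⟨LambdaInf.norm f.matrix (4 * (q + r + 1)) ξ *
      f.bound * Real.sqrt (∑' j : ℕ, ((j : ℝ) + 1) ^ (-2 : ℤ)), fun η hη =>
        (wnorm_diagFun_le ξ hη).trans (le_of_eq (by ring))⟩)

theorem diag_apply (ξ : LambdaInf f.matrix) (η : SDual) (j : ℕ) :
    diag ξ η j = ∑' k, ξ.1 k * pair η (f k) * f k j := rfl

theorem diag_apply_self (ξ : LambdaInf f.matrix) (l : ℕ) : diag ξ (incl (f l)) = ξ.1 l • f l :=
  S.ext fun j => by
    rw [diag_apply, tsum_eq_single l (fun k hk => by rw [f.orthonormal, if_neg hk.symm]; simp),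
      f.orthonormal, if_pos rfl, mul_one, S.smul_apply]

theorem star_diag (ξ : LambdaInf f.matrix) : star (diag ξ) = diag (star ξ) :=
  LSS.ext_unitVec fun l => S.ext fun i => by
    rw [LSS.star_apply, pair_unitVec, diag_apply, diag_apply, Complex.conj_tsum]
    refine tsum_congr fun k => ?_
    rw [pair_unitVec, pair_unitVec, map_mul, map_mul, Complex.conj_conj]
    change conj (ξ.1 k) * _ * _ = conj (ξ.1 k) * _ * _
    ring

/-! ### Operators that are diagonal with respect to an orthonormal sequence -/

/-- `x` is diagonal with respect to `(f_k)`, with diagonal entries `μ_k`. -/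
def IsDiag (f : OrthonormalSeq) (x : LSS) (μ : ℕ → ℂ) : Prop :=
  ∀ (η : SDual) (k : ℕ), pair (incl (x η)) (f k) = μ k * pair η (f k)

theorem isDiag_diag (ξ : LambdaInf f.matrix) : IsDiag f (diag ξ) ξ.1 := fun η k => by
  rw [pair_apply, star_diag, diag_apply_self, pair_smul_right]
  congr 1
  exact Complex.conj_conj (ξ.1 k)

theorem IsDiag.mul {x y : LSS} {μ ν : ℕ → ℂ} (hx : IsDiag f x μ) (hy : IsDiag f y ν) :
    IsDiag f (x * y) (μ * ν) := fun η k => by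
  rw [LSS.mul_apply, hx, hy, Pi.mul_apply, mul_assoc]

theorem OrthonormalSeq.IsSComplete.eq_of_pair (hf : f.IsSComplete) {ξ η : S}
    (h : ∀ k, pair (incl ξ) (f k) = pair (incl η) (f k)) : ξ = η := by
  refine sub_eq_zero.1 (hf _ fun k => ?_)
  change pairCLM (f k) (incl (ξ - η)) = 0
  rw [map_sub, map_sub, sub_eq_zero]
  exact h k

/-- By s-completeness the coefficients along (f_k) determine the values of an operator.
Commutativity of diagonal operators is inherited from ℂ in this way. -/
theorem IsDiag.eq (hf : f.IsSComplete) {x y : LSS} {μ : ℕ → ℂ} (hx : IsDiag f x μ)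
    (hy : IsDiag f y μ) : x = y :=
  LSS.ext fun η => hf.eq_of_pair fun k => by rw [hx, hy]

theorem IsDiag.commute (hf : f.IsSComplete) {x y : LSS} {μ ν : ℕ → ℂ} (hx : IsDiag f x μ)
    (hy : IsDiag f y ν) : x * y = y * x :=
  (hx.mul hy).eq hf (by rw [mul_comm]; exact hy.mul hx)

theorem rankOne_apply (g : S) (η : SDual) : rankOne g η = pair η g • g := rfl

/-- The diagonal entries `⟨x f_k, f_k⟩`. -/
def diagEntry (f : OrthonormalSeq) (x : LSS) (k : ℕ) : ℂ := pair (incl (x (incl (f k)))) (f k)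

theorem isDiag_of_commute {x : LSS} (h : ∀ k, rankOne (f k) * x = x * rankOne (f k)) :
    IsDiag f x (diagEntry f x) := fun η k => by
  have h1 := DFunLike.congr_fun (h k) η
  rw [LSS.mul_apply, LSS.mul_apply, rankOne_apply, rankOne_apply, map_smul, LSS.map_smul] at h1
  have h2 := congrArg (fun ζ => pair (incl ζ) (f k)) h1
  simp only [map_smul, pair_smul, f.orthonormal, if_true, mul_one] at h2
  rw [h2, diagEntry, mul_comm]

theorem apply_eq_smul_of_commute {x : LSS} {k : ℕ}
    (h : rankOne (f k) * x = x * rankOne (f k)) : x (incl (f k)) = diagEntry f x k • f k := by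
  have h1 := DFunLike.congr_fun h (incl (f k))
  rw [LSS.mul_apply, LSS.mul_apply, rankOne_apply, rankOne_apply, f.orthonormal, if_pos rfl,
    one_smul] at h1
  exact h1.symm

theorem IsDiag.diagEntry_eq {x : LSS} {μ : ℕ → ℂ} (hx : IsDiag f x μ) : diagEntry f x = μ :=
  funext fun k => by rw [diagEntry, hx, f.orthonormal, if_pos rfl, mul_one]

theorem diagEntry_star (x : LSS) (k : ℕ) :
    diagEntry f (star x) k = conj (diagEntry f x k) := by
  rw [diagEntry, pair_apply, LSS.star_star, ← pair_incl_conj]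
  rfl

theorem diagEntry_add (x y : LSS) (k : ℕ) :
    diagEntry f (x + y) k = diagEntry f x k + diagEntry f y k :=
  pair_add (incl (x (incl (f k)))) (incl (y (incl (f k)))) (f k)

theorem diagEntry_smul (c : ℂ) (x : LSS) (k : ℕ) :
    diagEntry f (c • x) k = c * diagEntry f x k :=
  pair_smul c (incl (x (incl (f k)))) (f k)

theorem norm_diagEntry_mul {x : LSS} {k : ℕ} (h : rankOne (f k) * x = x * rankOne (f k))
    (q : ℕ) : ‖diagEntry f x k‖ * S.norm q (f k) = S.norm q (x (incl (f k))) := by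
  rw [apply_eq_smul_of_commute h, map_smul_eq_mul]

/-- Each f_k is an eigenvector of x and has norm 1 in the step 0 of s', so |μ_k| |f_k|_q = |x f_k|_q
is bounded uniformly in k. -/
theorem mem_matrix_of_commute {x : LSS} (h : ∀ k, rankOne (f k) * x = x * rankOne (f k)) :
    f.matrix.Mem (diagEntry f x) := fun q => by
  obtain ⟨C, hC⟩ := SDual.exists_bound x q 0
  refine ⟨C, ?_⟩
  rintro _ ⟨k, rfl⟩
  change ‖diagEntry f x k‖ * S.norm q (f k) ≤ C
  rw [norm_diagEntry_mul (h k)]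
  have h1 := hC (incl (f k)) (incl_wsummable _ _)
  have h2 : wnorm (-((0 : ℕ) : ℤ)) (incl (f k)) = 1 := f.wnorm_zero k
  rwa [h2, mul_one] at h1

end

section

/-! ### The isomorphism with a Köthe algebra -/

theorem LambdaInf.withSeminorms (A : KotheMatrix) [A.IsAlgebra] :
    WithSeminorms (LambdaInf.norms A) := ⟨rfl⟩

theorem LambdaInf.ext {A : KotheMatrix} [A.IsAlgebra] {ξ η : LambdaInf A}
    (h : ∀ k, ξ.1 k = η.1 k) : ξ = η := Subtype.ext (funext h)

variable {E : NonUnitalStarSubalgebra ℂ LSS} {f : OrthonormalSeq}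

theorem IsSelfCentralizing.rankOne_commute (hE : IsSelfCentralizing E)
    (hP : ∀ k, rankOne (f k) ∈ E) {x : LSS} (hx : x ∈ E) (k : ℕ) :
    rankOne (f k) * x = x * rankOne (f k) := (hE x).1 hx _ (hP k)

theorem IsSelfCentralizing.mem_of_isDiag (hE : IsSelfCentralizing E)
    (hP : ∀ k, rankOne (f k) ∈ E) (hf : f.IsSComplete) {x : LSS} {μ : ℕ → ℂ}
    (hx : IsDiag f x μ) : x ∈ E :=
  (hE x).2 fun _ hy => (isDiag_of_commute (hE.rankOne_commute hP hy)).commute hf hx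

/-- The isomorphism sending an operator to the sequence of its diagonal entries. -/
def diagEquiv (hE : IsSelfCentralizing E) (hP : ∀ k, rankOne (f k) ∈ E) (hf : f.IsSComplete) :
    E ≃⋆ₐ[ℂ] LambdaInf f.matrix where
  toFun x := ⟨diagEntry f x.1, mem_matrix_of_commute (hE.rankOne_commute hP x.2)⟩
  invFun ξ := ⟨diag ξ, hE.mem_of_isDiag hP hf (isDiag_diag ξ)⟩
  left_inv x := Subtype.ext <|
    (isDiag_diag _).eq hf (isDiag_of_commute (hE.rankOne_commute hP x.2))
  right_inv ξ := Subtype.ext (isDiag_diag ξ).diagEntry_eq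
  map_mul' x y := Subtype.ext
    ((isDiag_of_commute (hE.rankOne_commute hP x.2)).mul
      (isDiag_of_commute (hE.rankOne_commute hP y.2))).diagEntry_eq
  map_add' x y := LambdaInf.ext fun k => diagEntry_add x.1 y.1 k
  map_star' x := LambdaInf.ext fun k => diagEntry_star x.1 k
  map_smul' c x := LambdaInf.ext fun k => diagEntry_smul c x.1 k

theorem diagEquiv_apply (hE : IsSelfCentralizing E) (hP : ∀ k, rankOne (f k) ∈ E)
    (hf : f.IsSComplete) (x : E) (k : ℕ) :
    (diagEquiv hE hP hf x).1 k = diagEntry f x.1 k := rfl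

/-! ### Continuity of the isomorphism in both directions -/

theorem LSS.eventually_bound {B : Set SDual} (hB : Bornology.IsVonNBounded ℂ B) (q : ℕ) {ε : ℝ}
    (hε : 0 < ε) : ∀ᶠ x : LSS in 𝓝 0, ∀ ξ ∈ B, S.norm q (x ξ) < ε := by
  have hU : {ζ : S | S.norm q ζ < ε} ∈ 𝓝 (0 : S) :=
    (S.withSeminorms.continuous_seminorm q).continuousAt.eventually_lt continuousAt_const
      (by simpa [S.norms] using hε)
  exact ContinuousLinearMap.eventually_nhds_zero_mapsTo (F := S) hB hU

/-- The q-th seminorm of the diagonal is sup_k |x f_k|_q, and all f_k lie in one bounded subset of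
s', the unit ball of ℓ₂. -/
theorem continuous_diagEquiv (hE : IsSelfCentralizing E) (hP : ∀ k, rankOne (f k) ∈ E)
    (hf : f.IsSComplete) : Continuous (diagEquiv hE hP hf) := by
  refine continuous_iff_continuousAt.2 fun x₀ => ?_
  refine ((LambdaInf.withSeminorms f.matrix).tendsto_nhds _ _).2 fun q ε hε => ?_
  have hsub : Filter.Tendsto (fun x : E => x.1 - x₀.1) (𝓝 x₀) (𝓝 0) := by
    have : IsTopologicalAddGroup LSS := inferInstanceAs (IsTopologicalAddGroup (SDual →L[ℂ] S))
    have h : Continuous fun x : E => x.1 - x₀.1 := continuous_subtype_val.sub continuous_const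
    simpa using h.tendsto x₀
  -- The bound ε/2 leaves room for the strict inequality lost in the supremum.
  filter_upwards [hsub.eventually
    (LSS.eventually_bound (SDual.isVonNBounded_ball 0 1) q (half_pos hε))] with x hx
  refine lt_of_le_of_lt ?_ (half_lt_self hε)
  refine ciSup_le fun k => ?_
  have h1 : (diagEquiv hE hP hf x - diagEquiv hE hP hf x₀).1 k = diagEntry f (x - x₀ : E).1 k := by
    rw [← diagEquiv_apply hE hP hf, map_sub]
  rw [h1]
  refine (norm_diagEntry_mul (hE.rankOne_commute hP (x - x₀).2 k) q).trans_le ?_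
  exact (hx (incl (f k)) ⟨incl_wsummable _ _, (f.wnorm_zero k).le⟩).le

theorem continuous_diag : Continuous (diag : LambdaInf f.matrix → LSS) := by
  have hA := LambdaInf.withSeminorms f.matrix
  have : IsTopologicalAddGroup (LambdaInf f.matrix) := hA.topologicalAddGroup
  have : IsTopologicalAddGroup LSS := inferInstanceAs (IsTopologicalAddGroup (SDual →L[ℂ] S))
  let T : LambdaInf f.matrix →+ LSS :=
    { toFun := diag
      map_zero' := LSS.ext fun η => S.ext fun j => by
        rw [diag_apply]
        refine Eq.trans (tsum_congr fun k => ?_) tsum_zero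
        change (0 : ℂ) * _ * _ = 0
        rw [zero_mul, zero_mul]
      map_add' := fun ξ ζ => LSS.ext fun η => S.ext fun j => by
        change _ = diag ξ η j + diag ζ η j
        rw [diag_apply, diag_apply, diag_apply,
          ← (summable_diag ξ η j).tsum_add (summable_diag ζ η j)]
        refine tsum_congr fun k => ?_
        change (ξ.1 k + ζ.1 k) * _ * _ = _
        ring }
  refine continuous_of_continuousAt_zero T ?_
  rw [ContinuousAt, map_zero]
  refine ((ContinuousLinearMap.hasBasis_nhds_zero_of_basis (σ := RingHom.id ℂ) (E := SDual) (F := S)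
    S.withSeminorms.hasBasis_zero_ball)).tendsto_right_iff.2 ?_
  rintro ⟨B, s, ε⟩ ⟨hB, hε⟩
  -- Since B is bounded in a single step r, `wnorm_diagFun_le` is uniform on B and involves just one
  -- seminorm of ξ for each q.
  obtain ⟨r, C, hC⟩ := SDual.exists_step_of_isVonNBounded hB
  have hq : ∀ q ∈ s, ∀ᶠ ξ : LambdaInf f.matrix in 𝓝 0, ∀ η ∈ B, S.norm q (diag ξ η) < ε := by
    intro q _
    have hc : Continuous fun ξ : LambdaInf f.matrix =>
        LambdaInf.norm f.matrix (4 * (q + r + 1)) ξ * |C| * f.bound *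
          Real.sqrt (∑' j : ℕ, ((j : ℝ) + 1) ^ (-2 : ℤ)) :=
      (((hA.continuous_seminorm (4 * (q + r + 1))).mul continuous_const).mul
        continuous_const).mul continuous_const
    have h0 := hc.continuousAt.eventually_lt (x₀ := 0) (continuousAt_const (y := ε))
      (by simpa using hε)
    filter_upwards [h0] with ξ hξ η hη
    refine lt_of_le_of_lt ((wnorm_diagFun_le ξ (hC η hη).1).trans ?_) hξ
    have hb : 0 ≤ f.bound := tsum_nonneg fun k => by positivity
    have hn : 0 ≤ LambdaInf.norm f.matrix (4 * (q + r + 1)) ξ := apply_nonneg _ _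
    gcongr
    exact (hC η hη).2.trans (le_abs_self C)
  filter_upwards [(s.eventually_all).2 hq] with ξ hξ η hη
  rw [Seminorm.mem_ball_zero]
  exact Seminorm.finset_sup_apply_lt hε fun q hqs => hξ q hqs η hη

theorem isFrechetIso_diagEquiv (hE : IsSelfCentralizing E) (hP : ∀ k, rankOne (f k) ∈ E)
    (hf : f.IsSComplete) : IsFrechetIso (diagEquiv hE hP hf) :=
  ⟨continuous_diagEquiv hE hP hf, continuous_diag.subtype_mk _⟩

theorem diagEquiv_rankOne (hE : IsSelfCentralizing E) (hP : ∀ k, rankOne (f k) ∈ E)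
    (hf : f.IsSComplete) (k : ℕ) :
    diagEquiv hE hP hf ⟨rankOne (f k), hP k⟩ = LambdaInf.e f.matrix k :=
  LambdaInf.ext fun l => by
    rw [diagEquiv_apply, diagEntry, rankOne_apply, map_smul, pair_smul, f.orthonormal,
      f.orthonormal]
    change _ = (Pi.single k 1 : ℕ → ℂ) l
    by_cases h : l = k
    · subst h; simp
    · rw [if_neg h, zero_mul, Pi.single_eq_of_ne h]

/-- In E one has x P_k = μ_k P_k for P_k = ⟨·, f_k⟩ f_k. Applying Φ and reading off the k-th
coordinate forces (Φ x)_k = μ_k. -/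
theorem eq_diagEquiv (hE : IsSelfCentralizing E) (hP : ∀ k, rankOne (f k) ∈ E)
    (hf : f.IsSComplete) (Φ : E ≃⋆ₐ[ℂ] LambdaInf f.matrix)
    (hΦ : ∀ k, Φ ⟨rankOne (f k), hP k⟩ = LambdaInf.e f.matrix k) : Φ = diagEquiv hE hP hf := by
  refine StarAlgEquiv.ext fun x => LambdaInf.ext fun k => ?_
  have h1 : x * ⟨rankOne (f k), hP k⟩ = diagEntry f x.1 k • (⟨rankOne (f k), hP k⟩ : E) := by
    refine Subtype.ext (LSS.ext fun η => ?_)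
    change x.1 (incl (rankOne (f k) η)) = diagEntry f x.1 k • rankOne (f k) η
    rw [rankOne_apply, map_smul, LSS.map_smul,
      apply_eq_smul_of_commute (hE.rankOne_commute hP x.2 k), smul_comm]
  have h2 := congrArg (fun ξ : LambdaInf f.matrix => ξ.1 k) (congrArg Φ h1)
  simp only [map_mul, map_smul, hΦ] at h2
  change (Φ x).1 k * (Pi.single k 1 : ℕ → ℂ) k = diagEntry f x.1 k * (Pi.single k 1 : ℕ → ℂ) k at h2
  rw [diagEquiv_apply]
  simpa using h2

/-! ### The subalgebra of diagonal operators -/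

theorem star_rankOne (g : S) : star (rankOne g) = rankOne g :=
  LSS.ext fun ξ => S.ext fun i => by
    rw [LSS.star_apply, rankOne_apply, rankOne_apply, pair_smul_right, pair_unitVec,
      Complex.conj_conj, S.smul_apply, mul_comm]

theorem isDiag_rankOne (f : OrthonormalSeq) (k : ℕ) :
    IsDiag f (rankOne (f k)) (Pi.single k 1) := fun η l => by
  rw [rankOne_apply, map_smul, pair_smul, f.orthonormal]
  by_cases h : l = k
  · subst h; simp
  · rw [if_neg (Ne.symm h), Pi.single_eq_of_ne h, mul_zero, zero_mul]

/-- The operators commuting with all `⟨·, f_k⟩ f_k`. -/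
def diagSubalgebra (f : OrthonormalSeq) : NonUnitalStarSubalgebra ℂ LSS :=
  starCentralizer (Set.range fun k => rankOne (f k)) <| by
    rintro _ ⟨k, rfl⟩
    exact ⟨k, (star_rankOne _).symm⟩

theorem mem_diagSubalgebra {x : LSS} :
    x ∈ diagSubalgebra f ↔ ∀ k, rankOne (f k) * x = x * rankOne (f k) :=
  Set.forall_mem_range

theorem rankOne_mem_diagSubalgebra (hf : f.IsSComplete) (k : ℕ) :
    rankOne (f k) ∈ diagSubalgebra f :=
  mem_diagSubalgebra.2 fun l => (isDiag_rankOne f l).commute hf (isDiag_rankOne f k)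

theorem isSelfCentralizing_diagSubalgebra (hf : f.IsSComplete) :
    IsSelfCentralizing (diagSubalgebra f) := fun _ =>
  ⟨fun hx _ hy => (isDiag_of_commute (mem_diagSubalgebra.1 hy)).commute hf
      (isDiag_of_commute (mem_diagSubalgebra.1 hx)),
    fun h => mem_diagSubalgebra.2 fun k => h _ (rankOne_mem_diagSubalgebra hf k)⟩

end

section

/-! ### Operators on `ℓ₂` induced by elements of `𝓛(s', s)` -/

/-- The operator on `ℓ₂` induced by `x`. -/
def LSS.opL2 (x : LSS) : L2 →L[ℂ] L2 :=
  S.toL2.comp ((show SDual →L[ℂ] S from x).comp (ofL2 0))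

theorem LSS.opL2_apply (x : LSS) (a : L2) : x.opL2 a = S.toL2 (x (ofL2 0 a)) := rfl

theorem ofL2_zero_apply (a : L2) (j : ℕ) : ofL2 0 a j = a j := by
  change ((((j : ℝ) + 1) ^ ((0 : ℕ) : ℤ) : ℝ) : ℂ) * a j = a j
  simp

theorem ofL2_zero_toL2 (ξ : S) : ofL2 0 (S.toL2 ξ) = incl ξ :=
  SDual.ext fun j => ofL2_zero_apply _ j

theorem inner_toL2_left (ξ : S) (a : L2) : inner ℂ (S.toL2 ξ) a = pair (ofL2 0 a) ξ := by
  rw [lp.inner_eq_tsum]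
  exact tsum_congr fun j => by rw [RCLike.inner_apply, ofL2_zero_apply]; rfl

theorem LSS.isSymmetric_opL2 {x : LSS} (hx : star x = x) :
    (x.opL2 : L2 →ₗ[ℂ] L2).IsSymmetric := fun a b => by
  change inner ℂ (S.toL2 (x (ofL2 0 a))) b = inner ℂ a (S.toL2 (x (ofL2 0 b)))
  rw [← inner_conj_symm a, inner_toL2_left, inner_toL2_left]
  nth_rw 1 [← hx]
  rw [pair_star]

theorem LSS.exists_norm_coord_le (x : LSS) :
    ∃ C : ℝ, ∀ (a : L2) (j : ℕ), ‖x (ofL2 0 a) j‖ ≤ C * ((j : ℝ) + 1) ^ (-2 : ℤ) * ‖a‖ := by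
  obtain ⟨C, hC⟩ := SDual.exists_bound x 2 0
  refine ⟨C, fun a j => ?_⟩
  have h1 := norm_coord_le ((x (ofL2 0 a)).2 2) j
  have h2 := hC (ofL2 0 a) (wsummable_ofL2 0 a)
  have h3 : wnorm (-((0 : ℕ) : ℤ)) (ofL2 0 a) = ‖a‖ := wnorm_ofL2 0 a
  rw [h3] at h2
  rw [zpow_neg, mul_right_comm, ← div_eq_mul_inv, le_div_iff₀ (by positivity)]
  exact h1.trans h2

/-- The rank one operator `a ↦ (x a)_j e_j` on `ℓ₂`. -/
def LSS.coordOp (x : LSS) (j : ℕ) : L2 →L[ℂ] L2 :=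
  (ContinuousLinearMap.toSpanSingleton ℂ (lp.single 2 j (1 : ℂ) : L2)).comp
    ((S.coordCLM j).comp ((show SDual →L[ℂ] S from x).comp (ofL2 0)))

theorem LSS.coordOp_apply (x : LSS) (j : ℕ) (a : L2) :
    x.coordOp j a = x (ofL2 0 a) j • (lp.single 2 j (1 : ℂ) : L2) := by
  change S.coordCLM j (x (ofL2 0 a)) • (lp.single 2 j (1 : ℂ) : L2) = _
  rw [S.coordCLM_apply]

/-- Since x maps ℓ₂ into s, its coordinate functionals have norms of order (j+1)^{-2}; the series of
row operators thus converges absolutely in operator norm, which yields compactness. -/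
theorem LSS.hasSum_coordOp (x : LSS) : HasSum x.coordOp x.opL2 := by
  obtain ⟨C, hC⟩ := x.exists_norm_coord_le
  have hC0 : 0 ≤ C := by
    have h := (norm_nonneg _).trans (hC (lp.single 2 0 (1 : ℂ)) 0)
    simpa [lp.norm_single] using h
  have hs : Summable x.coordOp := by
    refine Summable.of_norm_bounded (summable_inv_sq.mul_left C) fun j => ?_
    refine ContinuousLinearMap.opNorm_le_bound _ (by positivity) fun a => ?_
    rw [LSS.coordOp_apply, norm_smul, lp.norm_single (by simp), norm_one, mul_one]
    exact hC a j
  convert! hs.hasSum using 1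
  ext1 a
  have h1 := hs.hasSum.mapL (ContinuousLinearMap.apply ℂ L2 a)
  refine HasSum.unique ?_ h1
  convert! lp.hasSum_single (p := 2) (by simp) (x.opL2 a) using 1
  funext j
  rw [ContinuousLinearMap.apply_apply, LSS.coordOp_apply, ← lp.single_smul, smul_eq_mul, mul_one]
  rfl

theorem LSS.isCompactOperator_opL2 (x : LSS) : IsCompactOperator x.opL2 := by
  refine isCompactOperator_of_tendsto x.hasSum_coordOp (Filter.Eventually.of_forall fun s => ?_)
  have h : ∑ j ∈ s, x.coordOp j ∈ compactOperator (RingHom.id ℂ) L2 L2 :=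
    sum_mem fun j _ => (isCompactOperator_of_locallyCompactSpace_rng
      (ContinuousLinearMap.toSpanSingleton ℂ (lp.single 2 j (1 : ℂ) : L2))).comp_clm
        ((S.coordCLM j).comp ((show SDual →L[ℂ] S from x).comp (ofL2 0)))
  exact h

/-- The operator on `s` induced by `x`. -/
def LSS.opS (x : LSS) : Module.End ℂ S := ((show SDual →L[ℂ] S from x).comp incl).toLinearMap

theorem LSS.mem_eigenspace_opS {x : LSS} {μ : ℂ} {ξ : S} :
    ξ ∈ Module.End.eigenspace x.opS μ ↔ x (incl ξ) = μ • ξ := Module.End.mem_eigenspace_iff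

theorem LSS.finiteDimensional_eigenspace (x : LSS) {μ : ℂ} (hμ : μ ≠ 0) :
    FiniteDimensional ℂ (Module.End.eigenspace x.opS μ) := by
  have := ContinuousLinearMap.finite_dimensional_eigenspace x.isCompactOperator_opL2 μ hμ
  let T : Module.End.eigenspace x.opS μ →ₗ[ℂ] Module.End.eigenspace x.opL2.toLinearMap μ :=
    S.toL2.toLinearMap.restrict fun ξ hξ => by
      rw [Module.End.mem_eigenspace_iff]
      change S.toL2 (x (ofL2 0 (S.toL2 ξ))) = μ • S.toL2 ξ
      rw [ofL2_zero_toL2, LSS.mem_eigenspace_opS.1 hξ, _root_.map_smul]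
  exact FiniteDimensional.of_injective T fun ξ η h =>
    Subtype.ext (S.toL2_injective (congrArg Subtype.val h))

/-! ### Minimal projections of maximal commutative subalgebras -/

variable {E : NonUnitalStarSubalgebra ℂ LSS}

theorem exists_smul_pair_self_eq_one {v : S} (hv : v ≠ 0) :
    ∃ c : ℂ, c ≠ 0 ∧ pair (incl (c • v)) (c • v) = 1 := by
  have h : S.toL2 v ≠ 0 := fun h0 => hv (S.toL2_injective (by rw [h0, map_zero]))
  have hn : ((‖S.toL2 v‖ : ℝ) : ℂ) ≠ 0 := by exact_mod_cast norm_ne_zero_iff.2 h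
  refine ⟨((‖S.toL2 v‖ : ℝ) : ℂ)⁻¹, inv_ne_zero hn, ?_⟩
  rw [map_smul, pair_smul, pair_smul_right, ← norm_toL2_sq, map_inv₀, Complex.conj_ofReal]
  push_cast
  field_simp

theorem ne_zero_of_pair_self {f : S} (hf : pair (incl f) f = 1) : f ≠ 0 := by
  rintro rfl
  rw [map_zero] at hf
  have : pair 0 0 = 0 := (pairCLM 0).map_zero
  rw [this] at hf
  exact zero_ne_one hf

theorem IsSelfCentralizing.commute (hE : IsSelfCentralizing E) {x y : LSS} (hx : x ∈ E)
    (hy : y ∈ E) (ξ : SDual) : x (incl (y ξ)) = y (incl (x ξ)) :=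
  DFunLike.congr_fun ((hE y).1 hy x hx) ξ

/-- As E is self-adjoint, f is an eigenvector of both y and y*, with conjugate eigenvalues, so ⟨·,
f⟩ f commutes with y. -/
theorem IsSelfCentralizing.rankOne_mem (hE : IsSelfCentralizing E) {f : S}
    (h : ∀ y ∈ E, ∃ c : ℂ, y (incl f) = c • f) : rankOne f ∈ E := by
  rcases eq_or_ne f 0 with rfl | hf
  · have : rankOne 0 = 0 := LSS.ext fun η => smul_zero (pair η 0)
    rw [this]
    exact zero_mem E
  refine (hE _).2 fun y hy => LSS.ext fun η => ?_
  obtain ⟨c, hc⟩ := h y hy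
  obtain ⟨d, hd⟩ := h _ (star_mem hy)
  have hcd : c = conj d := by
    have h1 := pair_apply y (incl f) f
    rw [hc, hd, map_smul, pair_smul, pair_smul_right] at h1
    exact mul_right_cancel₀ (pair_self_ne_zero hf) h1
  rw [LSS.mul_apply, LSS.mul_apply, rankOne_apply, rankOne_apply, map_smul, LSS.map_smul, hc,
    pair_apply, hd, pair_smul_right, smul_smul, hcd, mul_comm]

/-- A nonzero finite dimensional subspace of `s` invariant under `E` contains a common
eigenvector. -/
theorem exists_common_eigenvector (hE : IsSelfCentralizing E) :
    ∀ (n : ℕ) (V : Submodule ℂ S) [FiniteDimensional ℂ V], Module.finrank ℂ V ≤ n → V ≠ ⊥ →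
      (∀ y ∈ E, ∀ v ∈ V, y (incl v) ∈ V) →
      ∃ v ∈ V, v ≠ 0 ∧ ∀ y ∈ E, ∃ c : ℂ, y (incl v) = c • v := by
  intro n
  induction n with
  | zero =>
    intro V _ hn hV _
    exact absurd (Submodule.finrank_eq_zero.1 (Nat.le_zero.1 hn)) hV
  | succ n ih =>
    intro V _ hn hV hinv
    -- If E acts on V by scalars, any nonzero vector works. Otherwise some y is not scalar on V, and
    -- one of its eigenspaces in V is nonzero, strictly smaller and, by commutativity, E-invariant.
    by_cases hs : ∀ y ∈ E, ∃ c : ℂ, ∀ v ∈ V, y (incl v) = c • v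
    · obtain ⟨v, hv, hv0⟩ := Submodule.exists_mem_ne_zero_of_ne_bot hV
      refine ⟨v, hv, hv0, fun y hy => ?_⟩
      obtain ⟨c, hc⟩ := hs y hy
      exact ⟨c, hc v hv⟩
    · push Not at hs
      obtain ⟨y, hy, hns⟩ := hs
      have : Nontrivial V := Submodule.nontrivial_iff_ne_bot.2 hV
      let T : Module.End ℂ V := y.opS.restrict (hinv y hy)
      obtain ⟨μ, hμ⟩ := Module.End.exists_eigenvalue T
      obtain ⟨w, hw⟩ := hμ.exists_hasEigenvector
      let W : Submodule ℂ S := V ⊓ Module.End.eigenspace y.opS μ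
      have hWV : W < V := by
        refine lt_of_le_of_ne inf_le_left fun hEq => ?_
        obtain ⟨v, hv, hne⟩ := hns μ
        rw [← hEq] at hv
        exact hne (LSS.mem_eigenspace_opS.1 hv.2)
      have hfin : FiniteDimensional ℂ W := Submodule.finiteDimensional_of_le hWV.le
      have hW : W ≠ ⊥ := by
        refine (Submodule.ne_bot_iff _).2 ⟨w.1, ⟨w.2, LSS.mem_eigenspace_opS.2 ?_⟩, ?_⟩
        · exact congrArg Subtype.val hw.apply_eq_smul
        · exact fun h => hw.2 (Subtype.ext h)
      obtain ⟨v, hv, hv'⟩ := ih W (by have := Submodule.finrank_lt_finrank_of_lt hWV; omega) hW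
        fun z hz v hv => ⟨hinv z hz v hv.1, LSS.mem_eigenspace_opS.2 <| by
          rw [hE.commute hy hz, LSS.mem_eigenspace_opS.1 hv.2, map_smul, LSS.map_smul]⟩
      exact ⟨v, hv.1, hv'⟩

theorem exists_rankOne_mem (hE : IsSelfCentralizing E) (V : Submodule ℂ S)
    [FiniteDimensional ℂ V] (hV : V ≠ ⊥) (hinv : ∀ y ∈ E, ∀ v ∈ V, y (incl v) ∈ V) :
    ∃ f ∈ V, pair (incl f) f = 1 ∧ rankOne f ∈ E := by
  obtain ⟨v, hv, hv0, hc⟩ := exists_common_eigenvector hE _ V le_rfl hV hinv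
  obtain ⟨c, -, h1⟩ := exists_smul_pair_self_eq_one hv0
  refine ⟨c • v, V.smul_mem c hv, h1, hE.rankOne_mem fun y hy => ?_⟩
  obtain ⟨d, hd⟩ := hc y hy
  exact ⟨d, by rw [map_smul, LSS.map_smul, hd, smul_comm]⟩

theorem rankOne_apply_self {f : S} (hf : pair (incl f) f = 1) : rankOne f (incl f) = f := by
  rw [rankOne_apply, hf, one_smul]

theorem isStarProjection_rankOne {f : S} (hf : pair (incl f) f = 1) :
    IsStarProjection (rankOne f) := by
  refine ⟨LSS.ext fun η => ?_, star_rankOne f⟩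
  rw [LSS.mul_apply, rankOne_apply f η, map_smul, LSS.map_smul, rankOne_apply_self hf]

/-- A projection Q of E below ⟨·, f⟩ f is c ⟨·, f⟩ f with c² = c, so c = 1 when Q is nonzero. -/
theorem isMinimalProjection_rankOne (hE : IsSelfCentralizing E) {f : S}
    (hf : pair (incl f) f = 1) (hmem : rankOne f ∈ E) : IsMinimalProjection E (rankOne f) where
  mem := hmem
  isStarProjection := isStarProjection_rankOne hf
  ne_zero h := by
    have h1 := rankOne_apply_self hf
    rw [h] at h1
    exact ne_zero_of_pair_self hf h1.symm
  minimal := by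
    intro Q hQ hproj hQ0 hQP
    have hQη : ∀ η, Q η = pair η f • Q (incl f) := fun η => by
      have h1 := DFunLike.congr_fun hQP η
      rw [LSS.mul_apply, rankOne_apply, map_smul, LSS.map_smul] at h1
      exact h1.symm
    obtain ⟨c, hc⟩ : ∃ c : ℂ, Q (incl f) = c • f := by
      have h1 := hE.commute hQ hmem (incl f)
      rw [rankOne_apply_self hf, rankOne_apply] at h1
      exact ⟨_, h1⟩
    have hcc : c * c = c := by
      have h1 : Q (incl (Q (incl f))) = Q (incl f) :=
        DFunLike.congr_fun hproj.isIdempotentElem (incl f)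
      rw [hc, map_smul, LSS.map_smul, hc, smul_smul] at h1
      have h2 := congrArg (fun ζ => pair (incl ζ) f) h1
      simpa [pair_smul, hf] using h2
    have hc0 : c ≠ 0 := by
      rintro rfl
      refine hQ0 (LSS.ext fun η => ?_)
      rw [hQη, hc, zero_smul, smul_zero]
      rfl
    have hc1 : c = 1 := mul_right_cancel₀ hc0 (by rw [hcc, one_mul])
    exact LSS.ext fun η => by rw [hQη, hc, hc1, one_smul, rankOne_apply]

/-- The eigenspace of P for the eigenvalue 1 is finite-dimensional by compactness and E-invariant.
It contains a unit common eigenvector f, and ⟨·, f⟩ f is a nonzero projection of E below P. -/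
theorem IsMinimalProjection.exists_rankOne_eq (hE : IsSelfCentralizing E) {P : LSS}
    (hP : IsMinimalProjection E P) : ∃ f : S, pair (incl f) f = 1 ∧ rankOne f = P := by
  have := P.finiteDimensional_eigenspace (one_ne_zero (α := ℂ))
  have hne : Module.End.eigenspace P.opS 1 ≠ ⊥ := by
    obtain ⟨η, hη⟩ : ∃ η, P η ≠ 0 := by
      by_contra! h
      exact hP.ne_zero (LSS.ext h)
    refine (Submodule.ne_bot_iff _).2 ⟨P η, LSS.mem_eigenspace_opS.2 ?_, hη⟩
    rw [one_smul]
    exact DFunLike.congr_fun hP.isStarProjection.isIdempotentElem η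
  obtain ⟨f, hfV, hf, hmem⟩ := exists_rankOne_mem hE _ hne fun y hy v hv =>
    LSS.mem_eigenspace_opS.2 <| by
      rw [hE.commute hP.mem hy, LSS.mem_eigenspace_opS.1 hv, one_smul, one_smul]
  have hPf : P (incl f) = f := by rw [LSS.mem_eigenspace_opS.1 hfV, one_smul]
  have hmin := isMinimalProjection_rankOne hE hf hmem
  refine ⟨f, hf, hP.minimal _ hmem hmin.isStarProjection hmin.ne_zero (LSS.ext fun η => ?_)⟩
  have hs : star P = P := hP.isStarProjection.isSelfAdjoint
  rw [LSS.mul_apply, rankOne_apply, rankOne_apply, pair_apply, hs, hPf]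

theorem apply_eq_smul_of_rankOne_mem (hE : IsSelfCentralizing E) {f : S}
    (hf : pair (incl f) f = 1) (hmem : rankOne f ∈ E) {y : LSS} (hy : y ∈ E) :
    ∃ c : ℂ, y (incl f) = c • f := by
  have h1 := hE.commute hy hmem (incl f)
  rw [rankOne_apply_self hf, rankOne_apply] at h1
  exact ⟨_, h1⟩

/-! ### Completeness of the one-dimensional projections -/

/-- The restriction of T to H is compact, symmetric and nonzero, so by the spectral theorem it has a
nonzero eigenvalue. -/
theorem exists_eigenvector_of_invariant {K : Type*} [NormedAddCommGroup K]
    [InnerProductSpace ℂ K] {T : K →L[ℂ] K} (hc : IsCompactOperator T)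
    (hs : (T : K →ₗ[ℂ] K).IsSymmetric) (H : Submodule ℂ K) [CompleteSpace H]
    (hinv : ∀ a ∈ H, T a ∈ H) {a : K} (ha : a ∈ H) (hTa : T a ≠ 0) :
    ∃ μ : ℂ, μ ≠ 0 ∧ ∃ b ∈ H, b ≠ 0 ∧ T b = μ • b := by
  let R : H →L[ℂ] H := T.restrict hinv
  have hRc : IsCompactOperator R := hc.restrict' hinv
  have hRs : R.IsSymmetric := hs.restrict_invariant hinv
  have hR0 : R ≠ 0 := fun h0 => by
    have h1 : R ⟨a, ha⟩ = 0 := by rw [h0, zero_apply]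
    exact hTa (congrArg Subtype.val h1)
  obtain ⟨μ, hμ, hμ0⟩ : ∃ μ, Module.End.HasEigenvalue (R : Module.End ℂ H) μ ∧ μ ≠ 0 := by
    by_contra! h
    exact hR0 ((ContinuousLinearMap.eq_zero_of_forall_hasEigenvalue_eq_zero hRc hRs).1 h)
  obtain ⟨b, hb⟩ := hμ.exists_hasEigenvector
  exact ⟨μ, hμ0, b.1, b.2, fun h => hb.2 (Subtype.ext h), congrArg Subtype.val hb.apply_eq_smul⟩

/-- The vectors of `ℓ₂` orthogonal to all unit vectors `f ∈ s` with `⟨·, f⟩ f ∈ E`. -/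
def rankOneOrthogonal (E : NonUnitalStarSubalgebra ℂ LSS) : Submodule ℂ L2 :=
  (Submodule.span ℂ {a | ∃ f : S, (pair (incl f) f = 1 ∧ rankOne f ∈ E) ∧ S.toL2 f = a})ᗮ

theorem mem_rankOneOrthogonal {a : L2} : a ∈ rankOneOrthogonal E ↔
    ∀ f : S, pair (incl f) f = 1 → rankOne f ∈ E → inner ℂ (S.toL2 f) a = 0 := by
  refine ⟨fun h f hf hmem => (Submodule.mem_orthogonal _ _).1 h _
    (Submodule.subset_span ⟨f, ⟨hf, hmem⟩, rfl⟩), fun h => (Submodule.mem_orthogonal _ _).2 ?_⟩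
  intro b hb
  induction hb using Submodule.span_induction with
  | mem b hb =>
    obtain ⟨f, ⟨hf, hmem⟩, rfl⟩ := hb
    exact h f hf hmem
  | zero => exact inner_zero_left a
  | add b c _ _ hb hc => rw [inner_add_left, hb, hc, add_zero]
  | smul c b _ hb => rw [inner_smul_left, hb, mul_zero]

/-- Only `0` is orthogonal to the ranges of all one-dimensional projections of `E`. -/
theorem eq_zero_of_orthogonal (hE : IsSelfCentralizing E) {ξ : S}
    (hξ : ∀ f : S, pair (incl f) f = 1 → rankOne f ∈ E → pair (incl ξ) f = 0) : ξ = 0 := by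
  by_contra hξ0
  -- If all of E annihilated ξ, the normalized ξ would be a common eigenvector, and ξ would have to
  -- be orthogonal to itself.
  obtain ⟨y, hy, hyξ⟩ : ∃ y ∈ E, y (incl ξ) ≠ 0 := by
    by_contra! h
    obtain ⟨c, hc, h1⟩ := exists_smul_pair_self_eq_one hξ0
    have h2 := hξ (c • ξ) h1 (hE.rankOne_mem fun y hy => ⟨0, by
      rw [map_smul, LSS.map_smul, h y hy, smul_zero, zero_smul]⟩)
    rw [map_smul, pair_smul, h2, mul_zero] at h1
    exact zero_ne_one h1
  -- This replaces y by a self-adjoint element of E; ⟨x ξ, ξ⟩ has the value ⟨y ξ, y ξ⟩ ≠ 0 up to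
  -- conjugation.
  let x : LSS := star y * y
  have hx : x ∈ E := mul_mem (star_mem hy) hy
  have hsx : star x = x := by rw [LSS.star_mul, LSS.star_star]
  have hxξ : x (incl ξ) ≠ 0 := fun h0 => by
    refine pair_self_ne_zero hyξ ?_
    rw [pair_apply]
    change pair (incl ξ) (x (incl ξ)) = 0
    rw [h0]
    exact (map_eq_zero (starRingEnd ℂ)).1 (pairConjCLM (incl ξ)).map_zero
  let H : Submodule ℂ L2 := rankOneOrthogonal E
  have hH : ∀ a : L2, a ∈ H ↔
      ∀ f : S, pair (incl f) f = 1 → rankOne f ∈ E → inner ℂ (S.toL2 f) a = 0 :=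
    fun a => mem_rankOneOrthogonal
  have : CompleteSpace H := (Submodule.isClosed_orthogonal _).completeSpace_coe
  have hsymm := LSS.isSymmetric_opL2 hsx
  have hinv : ∀ a ∈ H, x.opL2 a ∈ H := fun a ha => (hH _).2 fun f hf hmem => by
    obtain ⟨c, hc⟩ := apply_eq_smul_of_rankOne_mem hE hf hmem hx
    have h1 := hsymm (S.toL2 f) a
    have h2 : x.opL2 (S.toL2 f) = c • S.toL2 f := by
      rw [LSS.opL2_apply, ofL2_zero_toL2, hc, map_smul]
    refine h1.symm.trans ?_
    change inner ℂ (x.opL2 (S.toL2 f)) a = 0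
    rw [h2, inner_smul_left, (hH a).1 ha f hf hmem, mul_zero]
  obtain ⟨μ, hμ0, a, haH, ha0, hav⟩ := exists_eigenvector_of_invariant
    x.isCompactOperator_opL2 hsymm H hinv (a := S.toL2 ξ)
    ((hH _).2 fun f hf hmem => by
      rw [inner_toL2]
      exact hξ f hf hmem)
    (fun h1 => by
      rw [LSS.opL2_apply, ofL2_zero_toL2] at h1
      exact hxξ (S.toL2_injective (by rw [h1, _root_.map_zero])))
  rw [LSS.opL2_apply] at hav
  -- V is nonzero because the ℓ₂-eigenvector a satisfies x a = μ a with μ ≠ 0, and x a lies in s.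
  let V : Submodule ℂ S := Module.End.eigenspace x.opS μ ⊓ H.comap S.toL2.toLinearMap
  have hV : ∀ v, v ∈ V ↔ x (incl v) = μ • v ∧
      ∀ f : S, pair (incl f) f = 1 → rankOne f ∈ E → pair (incl v) f = 0 := fun v =>
    and_congr LSS.mem_eigenspace_opS ((hH _).trans (by simp only [← inner_toL2]; rfl))
  have := x.finiteDimensional_eigenspace hμ0
  have hfin : FiniteDimensional ℂ V := Submodule.finiteDimensional_of_le inf_le_left
  have hVne : V ≠ ⊥ := by
    refine (Submodule.ne_bot_iff _).2 ⟨x (ofL2 0 a), ⟨LSS.mem_eigenspace_opS.2 ?_, ?_⟩, ?_⟩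
    · rw [← ofL2_zero_toL2, hav, map_smul, LSS.map_smul]
    · change S.toL2 (x (ofL2 0 a)) ∈ H
      rw [hav]
      exact H.smul_mem _ haH
    · intro h0
      rw [h0, map_zero] at hav
      exact smul_ne_zero hμ0 ha0 hav.symm
  -- Elements of E preserve V: they commute with x, and their adjoints map each such f to a multiple
  -- of itself. The resulting unit vector in V is then orthogonal to itself.
  obtain ⟨f, hfV, hf, hmem⟩ := exists_rankOne_mem hE V hVne fun z hz v hv => by
    rw [hV] at hv ⊢
    refine ⟨by rw [hE.commute hx hz, hv.1, map_smul, LSS.map_smul], fun f hf hmem => ?_⟩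
    obtain ⟨c, hc⟩ := apply_eq_smul_of_rankOne_mem hE hf hmem (star_mem hz)
    rw [pair_apply, hc, pair_smul_right, hv.2 f hf hmem, mul_zero]
  have h1 := ((hV f).1 hfV).2 f hf hmem
  rw [hf] at h1
  exact one_ne_zero h1

end

section

/-! ### The canonical basis -/

variable {E : NonUnitalStarSubalgebra ℂ LSS}

theorem eq_smul_of_rankOne_eq {f g : S} (hf : pair (incl f) f = 1) (h : rankOne g = rankOne f) :
    f = pair (incl f) g • g := by
  rw [← rankOne_apply, h, rankOne_apply_self hf]

theorem IsCanonicalBasis.isSComplete (hE : IsSelfCentralizing E) {f : OrthonormalSeq}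
    (hf : IsCanonicalBasis E fun k => rankOne (f k)) : f.IsSComplete := fun ξ hξ =>
  eq_zero_of_orthogonal hE fun g hg hmem => by
    obtain ⟨k, hk⟩ := hf.exhaustive _ (isMinimalProjection_rankOne hE hg hmem)
    rw [eq_smul_of_rankOne_eq hg hk, pair_smul_right, hξ, mul_zero]

/-- If two commuting one-dimensional projections have non-orthogonal ranges, then commuting them on
f makes g a multiple of f, and minimality identifies the projections. -/
theorem pair_eq_zero_of_ne (hE : IsSelfCentralizing E) {f g : S} (hf : pair (incl f) f = 1)
    (hmf : rankOne f ∈ E) (hg : pair (incl g) g = 1) (hmg : rankOne g ∈ E)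
    (hne : rankOne f ≠ rankOne g) : pair (incl f) g = 0 := by
  by_contra hc
  have h1 := hE.commute hmg hmf (incl f)
  rw [rankOne_apply_self hf, rankOne_apply g, map_smul, LSS.map_smul, rankOne_apply f] at h1
  have h2 : g = pair (incl g) f • f := smul_right_injective S hc h1
  have hmin := isMinimalProjection_rankOne hE hg hmg
  refine hne ((isMinimalProjection_rankOne hE hf hmf).minimal _ hmg hmin.isStarProjection
    hmin.ne_zero (LSS.ext fun η => ?_)).symm
  rw [LSS.mul_apply, rankOne_apply g, rankOne_apply g, pair_apply, star_rankOne, rankOne_apply f,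
    ← h2]

/-- The unit vector `e_i` as an element of `s`. -/
def S.unit (i : ℕ) : S := ⟨Pi.single i 1, fun q => unitVec_wsummable q i⟩

theorem incl_unit (i : ℕ) : incl (S.unit i) = unitVec i := rfl

theorem not_finiteDimensional_S : ¬ FiniteDimensional ℂ S := fun _ => by
  have h : Orthonormal ℂ fun i => S.toL2 (S.unit i) := orthonormal_toL2 fun k l => by
    rw [incl_unit, pair_unitVec]
    change conj ((Pi.single l 1 : ℕ → ℂ) k) = _
    rw [Pi.single_apply]
    split_ifs <;> simp
  have hli : LinearIndependent ℂ S.unit :=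
    LinearIndependent.of_comp S.toL2.toLinearMap h.linearIndependent
  exact not_finite_iff_infinite.2 inferInstance hli.finite

theorem exists_canonicalBasis (hE : IsSelfCentralizing E) :
    ∃ f : OrthonormalSeq, IsCanonicalBasis E fun k => rankOne (f k) := by
  classical
  let M := {P : LSS // IsMinimalProjection E P}
  choose g hg hgP using fun P : M => P.2.exists_rankOne_eq hE
  have hmem : ∀ P : M, rankOne (g P) ∈ E := fun P => by rw [hgP]; exact P.2.mem
  have hortho : ∀ P Q : M, pair (incl (g P)) (g Q) = if P = Q then 1 else 0 := fun P Q => by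
    split_ifs with h
    · rw [h, hg]
    · refine pair_eq_zero_of_ne hE (hg P) (hmem P) (hg Q) (hmem Q) fun h' => h (Subtype.ext ?_)
      rwa [hgP, hgP] at h'
  have hcount : Countable M := by
    -- By Bessel for the j-th unit vector, only countably many g_P have a nonzero j-th coordinate;
    -- every g_P has some nonzero coordinate.
    have h1 : ∀ j, {P : M | g P j ≠ 0}.Countable := fun j => by
      have h2 := ((orthonormal_toL2 hortho).inner_products_summable
        (lp.single 2 j (1 : ℂ) : L2)).countable_support
      refine h2.mono fun P hP => ?_
      rw [Function.mem_support, inner_toL2_single]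
      simpa using hP
    refine Set.countable_univ_iff.1 ((Set.countable_iUnion h1).mono fun P _ => ?_)
    by_contra hcon
    refine ne_zero_of_pair_self (hg P) (S.ext fun j => ?_)
    by_contra hj
    exact hcon (Set.mem_iUnion.2 ⟨j, hj⟩)
  -- With finitely many projections, completeness would embed s in a finite-dimensional space.
  have hinf : Infinite M := by
    by_contra hfin
    have : Finite M := not_infinite_iff_finite.1 hfin
    let T : S →ₗ[ℂ] (M → ℂ) := LinearMap.pi fun P => ((pairCLM (g P)).comp incl).toLinearMap
    refine not_finiteDimensional_S (FiniteDimensional.of_injective T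
      ((injective_iff_map_eq_zero T).2 fun ξ hξ => eq_zero_of_orthogonal hE fun h hh hmh => ?_))
    let P : M := ⟨rankOne h, isMinimalProjection_rankOne hE hh hmh⟩
    have h0 : pair (incl ξ) (g P) = 0 := congrFun hξ P
    rw [eq_smul_of_rankOne_eq hh (hgP P), pair_smul_right, h0, mul_zero]
  obtain ⟨e⟩ : Nonempty (ℕ ≃ M) := nonempty_equiv_of_countable
  refine ⟨⟨fun k => g (e k), fun k l => by simp only [hortho, e.injective.eq_iff]⟩, ?_, ?_, ?_⟩
  · intro k l h
    simp only [hgP] at h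
    exact e.injective (Subtype.ext h)
  · intro k
    simp only [hgP]
    exact (e k).2
  · intro Q hQ
    exact ⟨e.symm ⟨Q, hQ⟩, by simp [hgP]⟩

end

end SmoothOp

end

theorem mainTheorem7 :
    (∀ E : NonUnitalStarSubalgebra ℂ LSS, IsClosedMaximalCommutative E →
      ∃ f : OrthonormalSeq, f.IsSComplete ∧ IsCanonicalBasis E (fun k => rankOne (f k)) ∧
        ∃ Φ : E ≃⋆ₐ[ℂ] LambdaInf f.matrix, IsFrechetIso Φ) ∧
    (∀ (E : NonUnitalStarSubalgebra ℂ LSS) (f : OrthonormalSeq), IsClosedMaximalCommutative E →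
      ∀ hf : IsCanonicalBasis E (fun k => rankOne (f k)),
        f.IsSComplete ∧
        ∃! Φ : E ≃⋆ₐ[ℂ] LambdaInf f.matrix, IsFrechetIso Φ ∧
          ∀ k, Φ ⟨rankOne (f k), (hf.isMinimalProjection k).mem⟩ = LambdaInf.e f.matrix k) ∧
    (∀ f : OrthonormalSeq, f.IsSComplete →
      ∃ E : NonUnitalStarSubalgebra ℂ LSS, IsClosedMaximalCommutative E ∧
        ∃ Φ : E ≃⋆ₐ[ℂ] LambdaInf f.matrix, IsFrechetIso Φ) := by

  refine ⟨fun E hE => ?_, fun E f hE hf => ?_, fun f hf => ?_⟩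
  · have hE' := hE.isSelfCentralizing
    obtain ⟨f, hf⟩ := exists_canonicalBasis hE'
    have hc := hf.isSComplete hE'
    exact ⟨f, hc, hf, diagEquiv hE' (fun k => (hf.isMinimalProjection k).mem) hc,
      isFrechetIso_diagEquiv hE' _ hc⟩
  · have hE' := hE.isSelfCentralizing
    have hc := hf.isSComplete hE'
    have hP := fun k => (hf.isMinimalProjection k).mem
    exact ⟨hc, diagEquiv hE' hP hc,
      ⟨isFrechetIso_diagEquiv hE' hP hc, diagEquiv_rankOne hE' hP hc⟩,
      fun Φ hΦ => eq_diagEquiv hE' hP hc Φ hΦ.2⟩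
  · have hE := isSelfCentralizing_diagSubalgebra hf
    exact ⟨diagSubalgebra f, hE.isClosedMaximalCommutative,
      diagEquiv hE (rankOne_mem_diagSubalgebra hf) hf, isFrechetIso_diagEquiv hE _ hf⟩
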